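/- Throughout, an \emph{\'etale groupoid} is a groupoid $G$ with a locally compact, Hausdorff, second countable topology for which composition and inversion are continuous and the range and source maps $r,s:G\to G^{(0)}$, $r(\gamma)=\gamma\gamma^{-1}$, $s(\gamma)=\gamma^{-1}\gamma$, are local homeomorphisms. A \emph{bisection} is an open set $X\subset G$ such that $s|_X$ and $r|_X$ are homeomorphisms onto open sets. A Borel probability measure $\mu$ on $G^{(0)}$ is \emph{$X$-balanced} if $\mu(XBX^{-1})=\mu(s(X)\cap B)$ for every Borel set $B\subset G^{(0)}$, and \emph{$\mathcal X$-balanced}, for a family $\mathcal X$ of bisections, if it is $X$-balanced for every $X\in\mathcal X$. The reduced $C^*$-algebra $C^*_{\rm red}(G)$ is the completion of the convolution $*$-algebra $C_c(G)$ in the norm of the regular representation on $\ell^2(G)=\bigoplus_{u\in G^{(0)}}\ell^2(s^{-1}(u))$ by left convolution; for $X\subset G$ open, $C_c(X)\subset C_c(G)$ consists of the functions with compact support contained in $X$; $C_0(G^{(0)})\subset C^*_{\rm red}(G)$ is the closure of $C_c(G^{(0)})$; $\mathbb E_{\rm red}:C^*_{\rm red}(G)\to C_0(G^{(0)})$ is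 the continuous extension of the restriction map $f\mapsto f|_{G^{(0)}}$, $f\in C_c(G)$; and $\phi_\mu(h)=\int h\,d\mu$ for $h\in C_0(G^{(0)})$. \textbf{Theorem.} Let $\mathcal W$ be a collection of bisections in an \'etale groupoid $G$, let $\mathcal X$ be the inverse semigroup generated by $\mathcal W$ (the smallest family of subsets of $G$ that contains $\mathcal W$ and is closed under products $XY$ and inverses $X^{-1}$), and let $\mu$ be a Borel probability measure on $G^{(0)}$. The following are equivalent: \begin{itemize} \item[(i)] $\mu$ is $\mathcal W$-balanced; \item[(ii)] $\mu$ is $\mathcal X$-balanced; \item[(iii)] $\phi_\mu\circ\mathbb E_{\rm red}$ is tracial on the $C^*$-subalgebra $C^*\big(C_0(G^{(0)})\cup\bigcup_{W\in\mathcal W}C_c(W)\big)$ of $C^*_{\rm red}(G)$, that is, $\phi_\mu(\mathbb E_{\rm red}(ab))=\phi_\mu(\mathbb E_{\rm red}(ba))$ for all $a,b$ in it. \end{itemize} Moreover, $$C^*\bigg(C_0(G^{(0)})\cup\bigcup_{W\in\mathcal W}C_c(W)\bigg)=\overline{\rm span}\bigg(C_0(G^{(0)})\cup\bigcup_{X\in\mathcal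 X}C_c(X)\bigg).$$ In particular, if $\mu$ is $\mathcal W$-balanced and $\mathcal X$ covers $G\smallsetminus G^{(0)}$, then $\phi_\mu\circ\mathbb E_{\rm red}$ is tracial on $C^*_{\rm red}(G)$. -/

import Mathlib

open Set Filter Topology MeasureTheory
open scoped ENNReal CompactlySupported ZeroAtInfty

namespace EtaleGpd

/-! Groupoids, with a partially defined product: `a * b` is meaningful only when
`Composable a b`, i.e. `(a, b) ∈ G⁽²⁾`; its other values are never used. -/

/-- An algebraic groupoid, given by its set of arrows. -/
class SetGroupoid (G : Type*) extends Mul G, Inv G where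
  Composable : G → G → Prop
  inv_inv' : ∀ a : G, a⁻¹⁻¹ = a
  composable_inv : ∀ a : G, Composable a a⁻¹
  composable_mul_left : ∀ {a b c : G}, Composable a b → Composable b c → Composable (a * b) c
  composable_mul_right : ∀ {a b c : G}, Composable a b → Composable b c → Composable a (b * c)
  assoc : ∀ {a b c : G}, Composable a b → Composable b c → a * (b * c) = (a * b) * c
  inv_mul_mul : ∀ {a b : G}, Composable a b → a⁻¹ * (a * b) = b
  mul_mul_inv : ∀ {a b : G}, Composable a b → (a * b) * b⁻¹ = a

open SetGroupoid

section Algebra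

variable {G : Type*} [SetGroupoid G]

/-- `u` is a unit: `u = u²`. -/
def IsUnitArrow (u : G) : Prop := Composable u u ∧ u * u = u

lemma composable_inv_left (a : G) : Composable a⁻¹ a := by
  simpa [inv_inv'] using composable_inv a⁻¹

lemma isUnitArrow_mul_inv (a : G) : IsUnitArrow (a * a⁻¹) := by
  have h := composable_mul_left (composable_inv a) (composable_inv_left a)
  refine ⟨composable_mul_right h (composable_inv a), ?_⟩
  rw [assoc h (composable_inv a)]
  congr 1
  simpa [inv_inv'] using mul_mul_inv (composable_inv a)

variable (G) in
/-- The unit space `G⁽⁰⁾`. -/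
abbrev UnitSpace : Type _ := {u : G // IsUnitArrow u}

variable (G) in
/-- The unit space as a subset of `G`. -/
def unitSet : Set G := {u | IsUnitArrow u}

/-- The range map `r(γ) = γ γ⁻¹`. -/
def rng (a : G) : UnitSpace G := ⟨a * a⁻¹, isUnitArrow_mul_inv a⟩

/-- The source map `s(γ) = γ⁻¹ γ`. -/
def src (a : G) : UnitSpace G :=
  ⟨a⁻¹ * a, by simpa [inv_inv'] using isUnitArrow_mul_inv a⁻¹⟩

lemma rng_mul_self (a : G) : (rng a : G) * a = a := by
  change a * a⁻¹ * a = a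
  simpa [inv_inv'] using mul_mul_inv (composable_inv a)

lemma mul_src_self (a : G) : a * (src a : G) = a := by
  change a * (a⁻¹ * a) = a
  simpa [inv_inv'] using inv_mul_mul (composable_inv_left a)

lemma composable_iff {a b : G} : Composable a b ↔ src a = rng b := by
  constructor
  · intro h
    apply Subtype.ext
    change a⁻¹ * a = b * b⁻¹
    have h1 := composable_mul_right (composable_inv_left a) h
    have h2 := composable_mul_left h (composable_inv b)
    calc a⁻¹ * a = a⁻¹ * ((a * b) * b⁻¹) := by rw [mul_mul_inv h]
      _ = (a⁻¹ * (a * b)) * b⁻¹ := assoc h1 h2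
      _ = b * b⁻¹ := by rw [inv_mul_mul h]
  · intro h
    have h' : a⁻¹ * a = b * b⁻¹ := congrArg Subtype.val h
    have h1 : Composable a (b * b⁻¹) := by
      rw [← h']
      exact composable_mul_right (composable_inv a) (composable_inv_left a)
    have h2 : Composable (b * b⁻¹) b := composable_mul_left (composable_inv b) (composable_inv_left b)
    have h3 := composable_mul_right h1 h2
    rwa [show b * b⁻¹ * b = b from rng_mul_self b] at h3

lemma rng_inv (a : G) : rng a⁻¹ = src a := by
  apply Subtype.ext; simp [rng, src, inv_inv']

lemma src_inv (a : G) : src a⁻¹ = rng a := by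
  apply Subtype.ext; simp [rng, src, inv_inv']

lemma src_mul {a b : G} (h : src a = rng b) : src (a * b) = src b := by
  have h1 := composable_mul_left (composable_iff.2 h) (composable_inv b)
  rw [composable_iff, rng_inv] at h1
  exact h1

lemma rng_mul {a b : G} (h : src a = rng b) : rng (a * b) = rng a := by
  have h1 := composable_mul_right (composable_inv_left a) (composable_iff.2 h)
  rw [composable_iff, src_inv] at h1
  exact h1.symm

lemma src_mul_inv {a b : G} (h : src a = src b) : src (a * b⁻¹) = rng b := by
  rw [src_mul (by rw [rng_inv, h]), src_inv]

lemma rng_mul_inv {a b : G} (h : src a = src b) : rng (a * b⁻¹) = rng a :=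
  rng_mul (by rw [rng_inv, h])

lemma mul_inv_mul {a b : G} (h : src a = src b) : a * b⁻¹ * b = a := by
  have := mul_mul_inv (composable_iff.2 (show src a = rng b⁻¹ by rw [rng_inv, h]))
  simpa [inv_inv'] using this

lemma mul_left_cancel' {a b c : G} (hb : src a = rng b) (hc : src a = rng c)
    (h : a * b = a * c) : b = c := by
  rw [← inv_mul_mul (composable_iff.2 hb), h, inv_mul_mul (composable_iff.2 hc)]

lemma mul_right_cancel' {a b c : G} (hb : src b = rng a) (hc : src c = rng a)
    (h : b * a = c * a) : b = c := by
  rw [← mul_mul_inv (composable_iff.2 hb), h, mul_mul_inv (composable_iff.2 hc)]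

lemma mul_inv_rev' {a b : G} (h : src a = rng b) : (a * b)⁻¹ = b⁻¹ * a⁻¹ := by
  have h1 : src b⁻¹ = rng a⁻¹ := by rw [src_inv, rng_inv, h]
  apply mul_left_cancel' (a := a * b) (by rw [rng_inv])
    (by rw [src_mul h, rng_mul h1, rng_inv])
  have e : a * b * (b⁻¹ * a⁻¹) = a * b * b⁻¹ * a⁻¹ :=
    assoc (composable_iff.2 (by rw [src_mul h, rng_inv])) (composable_iff.2 h1)
  rw [e, mul_mul_inv (composable_iff.2 h)]
  exact congrArg Subtype.val (rng_mul h)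

lemma mul_inv_inv {a b : G} (h : src a = src b) : (a * b⁻¹)⁻¹ = b * a⁻¹ := by
  rw [mul_inv_rev' (by rw [rng_inv, h]), inv_inv']

lemma inv_unit {u : G} (hu : IsUnitArrow u) : u⁻¹ = u := by
  have h1 := inv_mul_mul hu.1
  have h2 := mul_mul_inv hu.1
  rw [hu.2] at h1 h2
  have h3 := rng_mul_self u⁻¹
  simp only [rng, inv_inv', h1] at h3
  rw [h2] at h3
  exact h3.symm

lemma src_unit (u : UnitSpace G) : src (u : G) = u := by
  apply Subtype.ext; simp [src, inv_unit u.2, u.2.2]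

lemma rng_unit (u : UnitSpace G) : rng (u : G) = u := by
  apply Subtype.ext; simp [rng, inv_unit u.2, u.2.2]

lemma src_src (a : G) : src (src a : G) = src a := src_unit _

lemma mul_inv_src {a b : G} (h : src a = src b) : a * (src b : G)⁻¹ = a := by
  rw [inv_unit (src b).2, ← h, mul_src_self]

/-- The product `AB` of two subsets of a groupoid. -/
def setMul (A B : Set G) : Set G :=
  {c | ∃ a ∈ A, ∃ b ∈ B, Composable a b ∧ a * b = c}

/-- `A⁻¹ = {a⁻¹ : a ∈ A}`. -/
def setInv (A : Set G) : Set G := {c | ∃ a ∈ A, a⁻¹ = c}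

/-- The inverse semigroup generated by `W`: the smallest family of sets that contains `W` and is
closed under products and inverses. -/
inductive GeneratedInvSemigroup (W : Set (Set G)) : Set G → Prop
  | of {X : Set G} : X ∈ W → GeneratedInvSemigroup W X
  | mul {X Y : Set G} : GeneratedInvSemigroup W X → GeneratedInvSemigroup W Y →
      GeneratedInvSemigroup W (setMul X Y)
  | inv {X : Set G} : GeneratedInvSemigroup W X → GeneratedInvSemigroup W (setInv X)

/-- The family of all members of the inverse semigroup generated by `W`. -/
def invSemigroup (W : Set (Set G)) : Set (Set G) := {X | GeneratedInvSemigroup W X}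

/-- The convolution `(f × g)(γ) = ∑_{αβ = γ} f(α) g(β)`. -/
noncomputable def conv (f g : G → ℂ) (c : G) : ℂ :=
  ∑' p : {p : G × G // Composable p.1 p.2 ∧ p.1 * p.2 = c}, f p.1.1 * g p.1.2

/-- The involution `f^*(γ) = conj f(γ⁻¹)`. -/
noncomputable def invol (f : G → ℂ) (c : G) : ℂ := star (f c⁻¹)

open Classical in
/-- The matrix of left convolution by `f`. -/
noncomputable def convKernel (f : G → ℂ) (c b : G) : ℂ :=
  if src b = src c then f (c * b⁻¹) else 0

/-- Factorizations of `c b⁻¹` are the pairs `(c x⁻¹, x b⁻¹)` with `s(x) = s(c)`. -/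
def factorEquiv {c b : G} (h : src c = src b) : {x : G // src x = src c} ≃
    {p : G × G // Composable p.1 p.2 ∧ p.1 * p.2 = c * b⁻¹} where
  toFun x := ⟨(c * x.1⁻¹, x.1 * b⁻¹), by
    have hx := x.2
    have h1 : Composable (c * x.1⁻¹) x.1 := composable_iff.2 (src_mul_inv hx.symm)
    have h2 : Composable x.1 b⁻¹ := composable_iff.2 (by rw [rng_inv, hx, h])
    refine ⟨composable_mul_right h1 h2, ?_⟩
    dsimp only
    rw [assoc h1 h2, mul_inv_mul hx.symm]⟩
  invFun p := ⟨p.1.2 * b, by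
    have h1 := src_mul (composable_iff.1 p.2.1)
    rw [p.2.2, src_mul_inv h] at h1
    rw [src_mul h1.symm, h]⟩
  left_inv x := by
    apply Subtype.ext
    exact mul_inv_mul (x.2.trans h)
  right_inv p := by
    have h1 := src_mul (composable_iff.1 p.2.1)
    rw [p.2.2, src_mul_inv h] at h1
    apply Subtype.ext
    apply Prod.ext
    · dsimp only
      have e : c = p.1.1 * (p.1.2 * b) := by
        rw [assoc p.2.1 (composable_iff.2 h1.symm), p.2.2, mul_inv_mul h]
      have h3 : Composable p.1.1 (p.1.2 * b) :=
        composable_mul_right p.2.1 (composable_iff.2 h1.symm)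
      have := mul_mul_inv h3
      rwa [← e] at this
    · exact mul_mul_inv (composable_iff.2 h1.symm)

lemma conv_mul_inv (f g : G → ℂ) {c b : G} (h : src c = src b) :
    conv f g (c * b⁻¹) = ∑' x, convKernel f c x * convKernel g x b := by
  classical
  rw [conv, ← (factorEquiv h).tsum_eq]
  have : ∀ x : G, convKernel f c x * convKernel g x b =
      ({x | src x = src c} : Set G).indicator (fun x => f (c * x⁻¹) * g (x * b⁻¹)) x := by
    intro x
    by_cases hx : src x = src c
    · simp [convKernel, hx, h, Set.indicator]
    · simp [convKernel, hx, Set.indicator]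
  simp_rw [this]
  rw [← tsum_subtype]
  rfl

lemma kernel_conv (f g : G → ℂ) (c b : G) :
    convKernel (conv f g) c b = ∑' x, convKernel f c x * convKernel g x b := by
  by_cases h : src b = src c
  · rw [← conv_mul_inv f g h.symm]
    simp [convKernel, h]
  · have : ∀ x : G, convKernel f c x * convKernel g x b = 0 := by
      intro x
      by_cases hx : src x = src c
      · simp [convKernel, hx, h]
      · simp [convKernel, hx]
    simp_rw [this]
    simp [convKernel, h]

lemma conv_eq_kernel (f g : G → ℂ) (c : G) : conv f g c = ∑' x, convKernel f c x * g x := by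
  have h : src c = src (src c : G) := (src_src c).symm
  have h1 : c * (src c : G)⁻¹ = c := mul_inv_src rfl
  conv_lhs => rw [← h1]
  rw [conv_mul_inv f g h]
  congr 1
  ext x
  by_cases hx : src x = src c
  · have : x * (src c : G)⁻¹ = x := by rw [← hx]; exact mul_inv_src rfl
    simp [convKernel, hx, src_src, this]
  · simp [convKernel, hx]

lemma kernel_invol (f : G → ℂ) (c b : G) : convKernel (invol f) c b = star (convKernel f b c) := by
  by_cases h : src b = src c
  · simp [convKernel, h, invol, mul_inv_inv h.symm]
  · simp [convKernel, h, Ne.symm h]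

end Algebra

set_option linter.unusedSectionVars false

section Topology

/-- An étale groupoid: a groupoid with a locally compact Hausdorff second countable topology,
continuous operations, and range and source maps that are local homeomorphisms. -/
class EtaleGroupoid (G : Type*) [TopologicalSpace G] extends SetGroupoid G where
  t2 : T2Space G
  locallyCompact : LocallyCompactSpace G
  secondCountable : SecondCountableTopology G
  mul_continuousOn : ContinuousOn (fun p : G × G => p.1 * p.2) {p | Composable p.1 p.2}
  inv_continuous : Continuous fun a : G => a⁻¹
  isLocalHomeomorph_rng : IsLocalHomeomorph (rng : G → UnitSpace G)
  isLocalHomeomorph_src : IsLocalHomeomorph (src : G → UnitSpace G)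

attribute [instance] EtaleGroupoid.t2 EtaleGroupoid.locallyCompact EtaleGroupoid.secondCountable

open EtaleGroupoid

variable {G : Type*} [TopologicalSpace G] [EtaleGroupoid G]

/-- An (open) bisection: an open set on which `s` and `r` are homeomorphisms onto open sets. -/
def IsBisection (X : Set G) : Prop :=
  IsOpen X ∧ IsOpenEmbedding (X.domRestrict (src : G → UnitSpace G)) ∧
    IsOpenEmbedding (X.domRestrict (rng : G → UnitSpace G))

/-- A measure `μ` on the unit space is `X`-balanced if `μ(X B X⁻¹) = μ(s(X) ∩ B)` for all Borel
sets `B` of units. -/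
def IsBalanced [MeasurableSpace (UnitSpace G)] (μ : Measure (UnitSpace G)) (X : Set G) : Prop :=
  ∀ B : Set (UnitSpace G), MeasurableSet B →
    μ (Subtype.val ⁻¹' setMul (setMul X (Subtype.val '' B)) (setInv X)) = μ (src '' X ∩ B)

/-- `μ` is balanced for every member of a family of sets. -/
def IsFamilyBalanced [MeasurableSpace (UnitSpace G)] (μ : Measure (UnitSpace G))
    (Xs : Set (Set G)) : Prop :=
  ∀ X ∈ Xs, IsBalanced μ X

lemma isClosed_unitSet : IsClosed (unitSet G) := by
  have : unitSet G = {a : G | (rng a : G) = a} := by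
    ext a
    constructor
    · intro h
      exact congrArg Subtype.val (rng_unit ⟨a, h⟩)
    · intro h
      have h : (rng a : G) = a := h
      change IsUnitArrow a
      rw [← h]
      exact (rng a).2
  rw [this]
  exact isClosed_eq (continuous_subtype_val.comp isLocalHomeomorph_rng.continuous) continuous_id

lemma exists_chart (a : G) : ∃ U : Set G, IsOpen U ∧ a ∈ U ∧
    InjOn (rng : G → UnitSpace G) U ∧ InjOn (src : G → UnitSpace G) U := by
  obtain ⟨e, he, hr⟩ := isLocalHomeomorph_rng a
  obtain ⟨e', he', hs⟩ := isLocalHomeomorph_src a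
  refine ⟨e.source ∩ e'.source, e.open_source.inter e'.open_source, ⟨he, he'⟩, ?_, ?_⟩
  · rw [hr]; exact e.injOn.mono inter_subset_left
  · rw [hs]; exact e'.injOn.mono inter_subset_right

lemma exists_card_bound {K : Set G} (hK : IsCompact K) : ∃ N : ℕ, ∀ F : Finset G, ↑F ⊆ K →
    ((∃ u, ∀ a ∈ F, rng a = u) ∨ (∃ u, ∀ a ∈ F, src a = u)) → F.card ≤ N := by
  classical
  choose U hU haU hr hs using fun a : G => exists_chart a
  obtain ⟨t, -, ht⟩ := hK.elim_nhds_subcover U fun a _ => (hU a).mem_nhds (haU a)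
  refine ⟨t.card, fun F hF h => ?_⟩
  have hc : ∀ a ∈ F, ∃ x ∈ t, a ∈ U x := by
    intro a ha
    simpa using ht (hF ha)
  choose! φ hφt hφ using hc
  refine Finset.card_le_card_of_injOn φ hφt ?_
  intro a ha b hb hab
  have h1 := hφ a ha
  have h2 := hφ b hb
  rw [← hab] at h2
  rcases h with ⟨u, h⟩ | ⟨u, h⟩
  · exact hr _ h1 h2 ((h a ha).trans (h b hb).symm)
  · exact hs _ h1 h2 ((h a ha).trans (h b hb).symm)

lemma exists_sum_bound (f : C_c(G, ℂ)) : ∃ C : ℝ, 0 ≤ C ∧ ∀ F : Finset G,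
    ((∃ u, ∀ a ∈ F, rng a = u) ∨ (∃ u, ∀ a ∈ F, src a = u)) → ∑ a ∈ F, ‖f a‖ ≤ C := by
  classical
  obtain ⟨N, hN⟩ := exists_card_bound f.hasCompactSupport
  obtain ⟨M, hM⟩ := f.hasCompactSupport.exists_bound_of_continuous f.continuous
  have hM0 : 0 ≤ max M 0 := le_max_right _ _
  refine ⟨N * max M 0, by positivity, fun F hF => ?_⟩
  rw [← Finset.sum_filter_ne_zero]
  calc _ ≤ ((F.filter fun a => ‖f a‖ ≠ 0).card : ℝ) * max M 0 := by
        rw [← nsmul_eq_mul]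
        exact Finset.sum_le_card_nsmul _ _ _ fun a _ => (hM a).trans (le_max_left _ _)
    _ ≤ N * max M 0 := by
        gcongr
        apply hN
        · intro a ha
          have : f a ≠ 0 := by simpa using (Finset.mem_filter.1 (Finset.mem_coe.1 ha)).2
          exact subset_tsupport _ this
        · exact hF.imp (fun ⟨u, h⟩ => ⟨u, fun a ha => h a (Finset.mem_filter.1 ha).1⟩)
            (fun ⟨u, h⟩ => ⟨u, fun a ha => h a (Finset.mem_filter.1 ha).1⟩)

lemma convKernel_sum_row (f : G → ℂ) (c : G) (F : Finset G) : ∃ F' : Finset G,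
    (∃ u, ∀ a ∈ F', rng a = u) ∧ ∑ b ∈ F, ‖convKernel f c b‖ = ∑ a ∈ F', ‖f a‖ := by
  classical
  refine ⟨(F.filter fun b => src b = src c).image fun b => c * b⁻¹, ⟨rng c, ?_⟩, ?_⟩
  · intro a ha
    obtain ⟨b, hb, rfl⟩ := Finset.mem_image.1 ha
    exact rng_mul_inv (Finset.mem_filter.1 hb).2.symm
  · rw [Finset.sum_image, Finset.sum_filter]
    · refine Finset.sum_congr rfl fun b _ => ?_
      by_cases h : src b = src c <;> simp [convKernel, h]
    · intro a ha b hb hab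
      have ha := (Finset.mem_filter.1 (Finset.mem_coe.1 ha)).2
      have hb := (Finset.mem_filter.1 (Finset.mem_coe.1 hb)).2
      have := mul_left_cancel' (by rw [rng_inv, ha]) (by rw [rng_inv, hb]) hab
      rw [← inv_inv' a, this, inv_inv']

lemma convKernel_sum_col (f : G → ℂ) (b : G) (F : Finset G) : ∃ F' : Finset G,
    (∃ u, ∀ a ∈ F', src a = u) ∧ ∑ c ∈ F, ‖convKernel f c b‖ = ∑ a ∈ F', ‖f a‖ := by
  classical
  refine ⟨(F.filter fun c => src b = src c).image fun c => c * b⁻¹, ⟨rng b, ?_⟩, ?_⟩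
  · intro a ha
    obtain ⟨c, hc, rfl⟩ := Finset.mem_image.1 ha
    exact src_mul_inv (Finset.mem_filter.1 hc).2.symm
  · rw [Finset.sum_image, Finset.sum_filter]
    · refine Finset.sum_congr rfl fun c _ => ?_
      by_cases h : src b = src c <;> simp [convKernel, h]
    · intro a ha c hc hac
      have ha := (Finset.mem_filter.1 (Finset.mem_coe.1 ha)).2
      have hc := (Finset.mem_filter.1 (Finset.mem_coe.1 hc)).2
      exact mul_right_cancel' (by rw [rng_inv, ha]) (by rw [rng_inv, hc]) hac

lemma convKernel_bound (f : C_c(G, ℂ)) : ∃ C : ℝ, 0 ≤ C ∧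
    (∀ c, ∀ F : Finset G, ∑ b ∈ F, ‖convKernel f c b‖ ≤ C) ∧
    (∀ b, ∀ F : Finset G, ∑ c ∈ F, ‖convKernel f c b‖ ≤ C) := by
  obtain ⟨C, hC0, hC⟩ := exists_sum_bound f
  refine ⟨C, hC0, fun c F => ?_, fun b F => ?_⟩
  · obtain ⟨F', h1, h2⟩ := convKernel_sum_row f c F
    rw [h2]; exact hC F' (Or.inl h1)
  · obtain ⟨F', h1, h2⟩ := convKernel_sum_col f b F
    rw [h2]; exact hC F' (Or.inr h1)

lemma finite_convKernel_row (f : C_c(G, ℂ)) (c : G) :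
    {b | convKernel f c b ≠ 0}.Finite := by
  classical
  obtain ⟨N, hN⟩ := exists_card_bound f.hasCompactSupport
  by_contra hinf
  obtain ⟨F, hF, hcard⟩ := (Set.not_finite.1 hinf : Set.Infinite _).exists_subset_card_eq (N + 1)
  have hp : ∀ b ∈ F, src b = src c ∧ f (c * b⁻¹) ≠ 0 := by
    intro b hb
    have := hF hb
    simpa [convKernel] using this
  have := hN (F.image fun b => c * b⁻¹) ?_ (Or.inl ⟨rng c, ?_⟩)
  · rw [Finset.card_image_of_injOn, hcard] at this
    · omega
    · intro a ha b hb hab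
      have ha := (hp a ha).1
      have hb := (hp b hb).1
      have := mul_left_cancel' (by rw [rng_inv, ha]) (by rw [rng_inv, hb]) hab
      rw [← inv_inv' a, this, inv_inv']
  · intro a ha
    obtain ⟨b, hb, rfl⟩ := Finset.mem_image.1 (Finset.mem_coe.1 ha)
    exact subset_tsupport _ (hp b hb).2
  · intro a ha
    obtain ⟨b, hb, rfl⟩ := Finset.mem_image.1 ha
    exact rng_mul_inv (hp b hb).1.symm

/-! ### The regular representation on `ℓ²(G)` -/

variable (G) in
/-- The Hilbert space `ℓ²(G)`, the direct sum of the spaces `ℓ²(s⁻¹(u))` over all units `u`. -/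
abbrev L2 : Type _ := lp (fun _ : G => ℂ) 2

lemma summable_convKernel_mul (f : C_c(G, ℂ)) (g : G → ℂ) (c : G) :
    Summable fun b => convKernel f c b * g b :=
  summable_of_hasFiniteSupport ((finite_convKernel_row f c).subset fun b hb h => hb (by simp [h]))

lemma summable_L2 (ξ : L2 G) : Summable fun b => ‖ξ b‖ ^ 2 := by
  have := (lp.memℓp ξ).summable (by simp)
  simpa using this

lemma norm_sq_L2 (ξ : L2 G) : ‖ξ‖ ^ 2 = ∑' b, ‖ξ b‖ ^ 2 := by
  have := lp.norm_rpow_eq_tsum (by simp) ξ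
  simpa using this

lemma conv_sum_sq_le (f : C_c(G, ℂ)) {C : ℝ} (hC0 : 0 ≤ C)
    (hrow : ∀ c, ∀ F : Finset G, ∑ b ∈ F, ‖convKernel f c b‖ ≤ C)
    (hcol : ∀ b, ∀ F : Finset G, ∑ c ∈ F, ‖convKernel f c b‖ ≤ C)
    (ξ : L2 G) (S : Finset G) : ∑ c ∈ S, ‖conv f ξ c‖ ^ 2 ≤ (C * ‖ξ‖) ^ 2 := by
  have key : ∀ c, ∃ F : Finset G, ‖conv f ξ c‖ ^ 2 ≤
      C * ∑ b ∈ F, ‖convKernel f c b‖ * ‖ξ b‖ ^ 2 := by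
    intro c
    refine ⟨(finite_convKernel_row f c).toFinset, ?_⟩
    set F := (finite_convKernel_row f c).toFinset
    have e : conv f ξ c = ∑ b ∈ F, convKernel f c b * ξ b := by
      rw [conv_eq_kernel]
      refine tsum_eq_sum fun b hb => ?_
      have : convKernel f c b = 0 := by simpa [F] using hb
      simp [this]
    have h1 : ‖conv f ξ c‖ ≤
        ∑ b ∈ F, √‖convKernel f c b‖ * (√‖convKernel f c b‖ * ‖ξ b‖) := by
      rw [e]
      refine (norm_sum_le _ _).trans (Finset.sum_le_sum fun b _ => ?_)
      rw [← mul_assoc, Real.mul_self_sqrt (norm_nonneg _), norm_mul]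
    calc ‖conv f ξ c‖ ^ 2
        ≤ (∑ b ∈ F, √‖convKernel f c b‖ * (√‖convKernel f c b‖ * ‖ξ b‖)) ^ 2 := by gcongr
      _ ≤ (∑ b ∈ F, √‖convKernel f c b‖ ^ 2) * ∑ b ∈ F, (√‖convKernel f c b‖ * ‖ξ b‖) ^ 2 :=
          Finset.sum_mul_sq_le_sq_mul_sq _ _ _
      _ = (∑ b ∈ F, ‖convKernel f c b‖) * ∑ b ∈ F, ‖convKernel f c b‖ * ‖ξ b‖ ^ 2 := by
          simp only [mul_pow, Real.sq_sqrt (norm_nonneg _)]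
      _ ≤ C * ∑ b ∈ F, ‖convKernel f c b‖ * ‖ξ b‖ ^ 2 := by
          gcongr
          exact hrow c F
  classical
  choose F hF using key
  calc ∑ c ∈ S, ‖conv f ξ c‖ ^ 2
      ≤ ∑ c ∈ S, C * ∑ b ∈ S.biUnion F, ‖convKernel f c b‖ * ‖ξ b‖ ^ 2 := by
        refine Finset.sum_le_sum fun c hc => (hF c).trans ?_
        gcongr
        exact Finset.subset_biUnion_of_mem F hc
    _ = C * ∑ b ∈ S.biUnion F, (∑ c ∈ S, ‖convKernel f c b‖) * ‖ξ b‖ ^ 2 := by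
        rw [← Finset.mul_sum, Finset.sum_comm]
        simp_rw [Finset.sum_mul]
    _ ≤ C * ∑ b ∈ S.biUnion F, C * ‖ξ b‖ ^ 2 := by
        gcongr with b _
        exact hcol b S
    _ = C ^ 2 * ∑ b ∈ S.biUnion F, ‖ξ b‖ ^ 2 := by rw [← Finset.mul_sum]; ring
    _ ≤ C ^ 2 * ‖ξ‖ ^ 2 := by
        gcongr
        rw [norm_sq_L2]
        exact (summable_L2 ξ).sum_le_tsum _ fun _ _ => by positivity
    _ = _ := by ring

lemma exists_conv_bound (f : C_c(G, ℂ)) : ∃ C : ℝ, 0 ≤ C ∧ ∀ (ξ : L2 G) (S : Finset G),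
    ∑ c ∈ S, ‖conv f ξ c‖ ^ 2 ≤ (C * ‖ξ‖) ^ 2 := by
  obtain ⟨C, hC0, hr, hc⟩ := convKernel_bound f
  exact ⟨C, hC0, conv_sum_sq_le f hC0 hr hc⟩

lemma memℓp_conv (f : C_c(G, ℂ)) (ξ : L2 G) : Memℓp (conv f ξ) 2 := by
  obtain ⟨C, -, h⟩ := exists_conv_bound f
  refine memℓp_gen' (C := (C * ‖ξ‖) ^ 2) fun S => ?_
  simpa using h ξ S

/-- The regular representation: left convolution `ξ ↦ f × ξ` as a bounded operator on `ℓ²(G)`. -/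
noncomputable def regRep (f : C_c(G, ℂ)) : L2 G →L[ℂ] L2 G :=
  LinearMap.mkContinuousOfExistsBound
    { toFun := fun ξ => (⟨conv f ξ, memℓp_conv f ξ⟩ : L2 G)
      map_add' := fun ξ η => by
        ext c
        simp only [lp.coeFn_add, Pi.add_apply]
        simp only [conv_eq_kernel, Pi.add_apply, mul_add]
        exact (summable_convKernel_mul f ξ c).tsum_add (summable_convKernel_mul f η c)
      map_smul' := fun z ξ => by
        ext c
        simp only [lp.coeFn_smul, Pi.smul_apply, RingHom.id_apply]
        simp only [conv_eq_kernel, Pi.smul_apply, smul_eq_mul]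
        rw [← tsum_mul_left]
        exact tsum_congr fun b => by ring }
    (by
      obtain ⟨C, hC0, h⟩ := exists_conv_bound f
      refine ⟨C, fun ξ => lp.norm_le_of_forall_sum_le (by simp) (by positivity) fun S => ?_⟩
      simpa using h ξ S)

lemma regRep_apply (f : C_c(G, ℂ)) (ξ : L2 G) (c : G) : regRep f ξ c = conv f ξ c := rfl

open Classical in
/-- The vector `δ_b` of the standard basis of `ℓ²(G)`. -/
noncomputable def delta (b : G) : L2 G := lp.single 2 b 1

lemma regRep_delta (f : C_c(G, ℂ)) (b c : G) : regRep f (delta b) c = convKernel f c b := by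
  classical
  rw [regRep_apply, conv_eq_kernel, tsum_eq_single b]
  · simp [delta]
  · intro x hx
    simp [delta, hx]

lemma ext_delta {S T : L2 G →L[ℂ] L2 G} (h : ∀ b c, S (delta b) c = T (delta b) c) : S = T := by
  classical
  refine lp.ext_continuousLinearMap (by simp) fun b => ?_
  ext c
  simpa [delta] using h b c

lemma inner_delta (c : G) (ξ : L2 G) : inner ℂ (delta c) ξ = ξ c := by
  classical
  simp [delta, lp.inner_single_left]

/-! ### The convolution `*`-algebra `C_c(G)` -/

lemma continuous_conv_of_chart {f g : G → ℂ} (hf : Continuous f) (hg : Continuous g)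
    (hfc : HasCompactSupport f) (e : OpenPartialHomeomorph G (UnitSpace G))
    (he : (rng : G → UnitSpace G) = e) (hfe : tsupport f ⊆ e.source) :
    Continuous (conv f g) := by
  have hrc : Continuous (rng : G → UnitSpace G) := isLocalHomeomorph_rng.continuous
  have hzero : ∀ c : G, (∀ a, rng a = rng c → f a = 0) → conv f g c = 0 := by
    intro c h
    rw [conv]
    convert tsum_zero with p
    rw [h p.1.1 ((rng_mul (composable_iff.1 p.2.1)).symm.trans (congrArg rng p.2.2)), zero_mul]
  rw [continuous_iff_continuousAt]
  intro c
  by_cases hc : rng c ∈ e.target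
  · have hV : IsOpen ((rng : G → UnitSpace G) ⁻¹' e.target) := e.open_target.preimage hrc
    have hσ : ∀ d, rng d ∈ e.target → rng (e.symm (rng d)) = rng d := by
      intro d hd
      exact (congrFun he _).trans (e.right_inv hd)
    have heq : ∀ d ∈ (rng : G → UnitSpace G) ⁻¹' e.target,
        conv f g d = f (e.symm (rng d)) * g ((e.symm (rng d))⁻¹ * d) := by
      intro d hd
      have hcomp : Composable (e.symm (rng d))⁻¹ d :=
        composable_iff.2 (by rw [src_inv, hσ d hd])
      have hcomp' : Composable (e.symm (rng d)) ((e.symm (rng d))⁻¹ * d) :=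
        composable_mul_right (composable_inv _) hcomp
      have hprod : e.symm (rng d) * ((e.symm (rng d))⁻¹ * d) = d := by
        rw [assoc (composable_inv _) hcomp]
        change (rng (e.symm (rng d)) : G) * d = d
        rw [hσ d hd, rng_mul_self]
      rw [conv, tsum_eq_single ⟨(e.symm (rng d), (e.symm (rng d))⁻¹ * d), hcomp', hprod⟩]
      rintro ⟨⟨a, b⟩, hab, hd'⟩ hne
      by_cases ha : f a = 0
      · simp [ha]
      · exfalso
        apply hne
        have has : a ∈ e.source := hfe (subset_tsupport _ ha)
        have hra : rng a = rng d := by rw [← hd', rng_mul (composable_iff.1 hab)]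
        have : e.symm (rng d) = a := by
          rw [← hra]
          exact (congrArg e.symm (congrFun he a)).trans (e.left_inv has)
        apply Subtype.ext
        apply Prod.ext
        · exact this.symm
        · dsimp only at hd' hab ⊢
          rw [this, ← hd', inv_mul_mul hab]
    have hcont : ContinuousOn (fun d => f (e.symm (rng d)) * g ((e.symm (rng d))⁻¹ * d))
        ((rng : G → UnitSpace G) ⁻¹' e.target) := by
      have h1 : ContinuousOn (fun d : G => e.symm (rng d)) ((rng : G → UnitSpace G) ⁻¹' e.target) :=
        e.continuousOn_symm.comp hrc.continuousOn fun d hd => hd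
      refine (hf.comp_continuousOn h1).mul (hg.comp_continuousOn ?_)
      refine mul_continuousOn.comp ((inv_continuous.comp_continuousOn h1).prodMk continuousOn_id) ?_
      intro d hd
      exact composable_iff.2 ((src_inv _).trans (hσ d hd))
    exact (hcont.congr heq).continuousAt (hV.mem_nhds hc)
  · have hcl : IsClosed ((rng : G → UnitSpace G) ⁻¹' (rng '' tsupport f)) :=
      (hfc.image hrc).isClosed.preimage hrc
    have hev : conv f g =ᶠ[𝓝 c] fun _ => 0 := by
      have hcn : c ∈ ((rng : G → UnitSpace G) ⁻¹' (rng '' tsupport f))ᶜ := by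
        rintro ⟨a, ha, hac⟩
        apply hc
        rw [← hac, he]
        exact e.map_source (hfe ha)
      filter_upwards [hcl.isOpen_compl.mem_nhds hcn] with d hd
      apply hzero
      intro a ha
      by_contra hfa
      exact hd ⟨a, subset_tsupport _ hfa, ha⟩
    exact continuousAt_const.congr hev.symm

lemma continuous_conv (f g : C_c(G, ℂ)) : Continuous (conv f g) := by
  classical
  choose e hae he using fun a : G => isLocalHomeomorph_rng (G := G) a
  obtain ⟨t, -, ht⟩ := f.hasCompactSupport.elim_nhds_subcover (fun a => (e a).source)
    fun a _ => (e a).open_source.mem_nhds (hae a)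
  let φ := t.equivFin.symm
  obtain ⟨p, hp, hp1, -, -⟩ := exists_continuous_sum_one_of_isOpen_isCompact
    (s := fun i => (e (φ i)).source) (fun i => (e (φ i)).open_source) f.hasCompactSupport
    (by
      intro x hx
      obtain ⟨a, ha, hxa⟩ := Set.mem_iUnion₂.1 (ht hx)
      exact Set.mem_iUnion.2 ⟨φ.symm ⟨a, ha⟩, by simpa using hxa⟩)
  have hcomp : ∀ i, HasCompactSupport fun x => (p i x : ℂ) * f x :=
    fun i => f.hasCompactSupport.mul_left
  let q : Fin t.card → C_c(G, ℂ) := fun i =>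
    ⟨⟨fun x => (p i x : ℂ) * f x, by fun_prop⟩, hcomp i⟩
  have hsum : ∀ x, f x = ∑ i, q i x := by
    intro x
    change f x = ∑ i, (p i x : ℂ) * f x
    by_cases hx : x ∈ tsupport f
    · have h1 : ∑ i, p i x = 1 := by simpa using hp1 hx
      rw [← Finset.sum_mul, ← Complex.ofReal_sum, h1]
      simp
    · simp [image_eq_zero_of_notMem_tsupport hx]
  have hconv : conv f g = fun c => ∑ i, conv (q i) g c := by
    ext c
    simp only [conv_eq_kernel]
    rw [← Summable.tsum_finsetSum fun i _ => summable_convKernel_mul (q i) g c]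
    refine tsum_congr fun b => ?_
    rw [← Finset.sum_mul]
    congr 1
    by_cases h : src b = src c <;> simp [convKernel, h, hsum]
  rw [hconv]
  refine continuous_finsetSum _ fun i _ => ?_
  refine continuous_conv_of_chart (q i).continuous g.continuous (hcomp i) (e (φ i)) (he _) ?_
  refine subset_trans (closure_mono fun x hx => ?_) (hp i)
  have hx : (p i x : ℂ) * f x ≠ 0 := hx
  simpa using left_ne_zero_of_mul hx

lemma hasCompactSupport_conv (f g : C_c(G, ℂ)) : HasCompactSupport (conv f g) := by
  have hK : IsCompact ((tsupport f ×ˢ tsupport g) ∩ {p : G × G | Composable p.1 p.2}) := by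
    refine (f.hasCompactSupport.prod g.hasCompactSupport).inter_right ?_
    simp only [composable_iff]
    exact isClosed_eq (isLocalHomeomorph_src.continuous.comp continuous_fst)
      (isLocalHomeomorph_rng.continuous.comp continuous_snd)
  have hK' := hK.image_of_continuousOn (mul_continuousOn.mono inter_subset_right)
  refine HasCompactSupport.intro hK' fun c hc => ?_
  rw [conv]
  convert tsum_zero with p
  by_contra hne
  apply hc
  exact ⟨p.1, ⟨⟨subset_tsupport _ (left_ne_zero_of_mul hne),
    subset_tsupport _ (right_ne_zero_of_mul hne)⟩, p.2.1⟩, p.2.2⟩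

/-- The product `f × g` of `C_c(G)`. -/
noncomputable def ccMul (f g : C_c(G, ℂ)) : C_c(G, ℂ) :=
  ⟨⟨conv f g, continuous_conv f g⟩, hasCompactSupport_conv f g⟩

/-- The involution `f^*` of `C_c(G)`. -/
noncomputable def ccStar (f : C_c(G, ℂ)) : C_c(G, ℂ) :=
  ⟨⟨invol f, (f.continuous.comp inv_continuous).star⟩, by
    refine HasCompactSupport.intro (f.hasCompactSupport.image inv_continuous) fun c hc => ?_
    have : f c⁻¹ = 0 := by
      by_contra h
      exact hc ⟨c⁻¹, subset_tsupport _ h, inv_inv' c⟩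
    simp [invol, this]⟩

lemma regRep_mul (f g : C_c(G, ℂ)) : regRep (ccMul f g) = regRep f * regRep g := by
  refine ext_delta fun b c => ?_
  rw [regRep_delta]
  change convKernel (conv f g) c b = regRep f (regRep g (delta b)) c
  rw [kernel_conv, regRep_apply, conv_eq_kernel]
  simp only [regRep_delta]

lemma regRep_star (f : C_c(G, ℂ)) : regRep (ccStar f) = star (regRep f) := by
  refine ext_delta fun b c => ?_
  rw [regRep_delta, ContinuousLinearMap.star_eq_adjoint, ← inner_delta c,
    ContinuousLinearMap.adjoint_inner_right, ← inner_conj_symm, inner_delta, regRep_delta]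
  exact kernel_invol f c b

lemma regRep_add (f g : C_c(G, ℂ)) : regRep (f + g) = regRep f + regRep g := by
  refine ext_delta fun b c => ?_
  rw [regRep_delta, add_apply, lp.coeFn_add, Pi.add_apply, regRep_delta, regRep_delta]
  by_cases h : src b = src c <;> simp [convKernel, h]

lemma regRep_smul (z : ℂ) (f : C_c(G, ℂ)) : regRep (z • f) = z • regRep f := by
  refine ext_delta fun b c => ?_
  rw [regRep_delta, smul_apply, lp.coeFn_smul, Pi.smul_apply, regRep_delta]
  by_cases h : src b = src c <;> simp [convKernel, h]

variable (G) in
/-- The image of the convolution algebra `C_c(G)` under the regular representation. -/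
noncomputable def regImage : NonUnitalStarSubalgebra ℂ (L2 G →L[ℂ] L2 G) where
  carrier := Set.range regRep
  add_mem' := by
    rintro _ _ ⟨f, rfl⟩ ⟨g, rfl⟩
    exact ⟨f + g, regRep_add f g⟩
  zero_mem' := ⟨0, by simpa using regRep_smul (G := G) 0 0⟩
  mul_mem' := by
    rintro _ _ ⟨f, rfl⟩ ⟨g, rfl⟩
    exact ⟨ccMul f g, regRep_mul f g⟩
  smul_mem' := by
    rintro z _ ⟨f, rfl⟩
    exact ⟨z • f, regRep_smul z f⟩
  star_mem' := by
    rintro _ ⟨f, rfl⟩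
    exact ⟨ccStar f, regRep_star f⟩

variable (G) in
/-- The reduced groupoid `C^*`-algebra: the norm closure of `C_c(G)` in the regular
representation. -/
noncomputable def CStarRed : NonUnitalStarSubalgebra ℂ (L2 G →L[ℂ] L2 G) :=
  (regImage G).topologicalClosure

instance : ContinuousStar (CStarRed G) :=
  ⟨Continuous.subtype_mk (continuous_star.comp continuous_subtype_val) _⟩

/-- The canonical embedding `C_c(G) ⊆ C^*_red(G)`. -/
noncomputable def toCStarRed (f : C_c(G, ℂ)) : CStarRed G :=
  ⟨regRep f, (regImage G).le_topologicalClosure ⟨f, rfl⟩⟩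

/-! ### The natural expectation -/

/-- The diagonal of an operator, `u ↦ ⟨δ_u, T δ_u⟩`; on `C_c(G)` it is the restriction to the
unit space. -/
noncomputable def diag (T : L2 G →L[ℂ] L2 G) (u : UnitSpace G) : ℂ := T (delta (u : G)) u

lemma diag_regRep (f : C_c(G, ℂ)) (u : UnitSpace G) : diag (regRep f) u = f u := by
  rw [diag, regRep_delta]
  simp [convKernel, inv_unit u.2, u.2.2]

lemma norm_diag_le (T : L2 G →L[ℂ] L2 G) (u : UnitSpace G) : ‖diag T u‖ ≤ ‖T‖ := by
  classical
  have h1 : ‖(delta (u : G) : L2 G)‖ = 1 := by simp [delta, lp.norm_single]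
  calc ‖diag T u‖ ≤ ‖T (delta (u : G))‖ := lp.norm_apply_le_norm (by simp) _ _
    _ ≤ ‖T‖ * ‖(delta (u : G) : L2 G)‖ := T.le_opNorm _
    _ = ‖T‖ := by rw [h1, mul_one]

lemma diag_sub (S T : L2 G →L[ℂ] L2 G) (u : UnitSpace G) :
    diag (S - T) u = diag S u - diag T u := by
  simp [diag]

lemma exists_approx (a : CStarRed G) {ε : ℝ} (hε : 0 < ε) :
    ∃ f : C_c(G, ℂ), ∀ u, ‖diag (a : L2 G →L[ℂ] L2 G) u - f u‖ < ε := by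
  have ha : (a : L2 G →L[ℂ] L2 G) ∈ closure (Set.range (regRep (G := G))) := a.2
  obtain ⟨_, ⟨f, rfl⟩, hf⟩ := Metric.mem_closure_iff.1 ha ε hε
  refine ⟨f, fun u => ?_⟩
  rw [← diag_regRep, ← diag_sub]
  rw [dist_eq_norm] at hf
  exact (norm_diag_le _ u).trans_lt hf

lemma continuous_diag (a : CStarRed G) : Continuous (diag (a : L2 G →L[ℂ] L2 G)) := by
  refine continuous_of_uniform_approx_of_continuous fun V hV => ?_
  obtain ⟨ε, hε, h⟩ := Metric.mem_uniformity_dist.1 hV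
  obtain ⟨f, hf⟩ := exists_approx a hε
  refine ⟨fun u => f u, f.continuous.comp continuous_subtype_val, fun u => h ?_⟩
  rw [dist_eq_norm]
  exact hf u

lemma zero_at_infty_diag (a : CStarRed G) :
    Tendsto (diag (a : L2 G →L[ℂ] L2 G)) (cocompact (UnitSpace G)) (𝓝 0) := by
  rw [Metric.tendsto_nhds]
  intro ε hε
  obtain ⟨f, hf⟩ := exists_approx a hε
  have hemb : IsClosedEmbedding (Subtype.val : UnitSpace G → G) :=
    isClosed_unitSet.isClosedEmbedding_subtypeVal
  filter_upwards [(hemb.isCompact_preimage f.hasCompactSupport).compl_mem_cocompact] with u hu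
  have h0 : f u = 0 := image_eq_zero_of_notMem_tsupport hu
  simpa [h0] using hf u

variable (G) in
/-- The natural conditional expectation `E_red : C^*_red(G) → C_0(G⁽⁰⁾)`, the continuous extension
of the restriction map `C_c(G) → C_c(G⁽⁰⁾)`. -/
noncomputable def expRed : CStarRed G →L[ℂ] C₀(UnitSpace G, ℂ) :=
  LinearMap.mkContinuous
    { toFun := fun a => ⟨⟨diag (a : L2 G →L[ℂ] L2 G), continuous_diag a⟩, zero_at_infty_diag a⟩
      map_add' := fun a b => by ext u; simp [diag]
      map_smul' := fun z a => by ext u; simp [diag] }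
    1 (fun a => by
      rw [← ZeroAtInftyContinuousMap.norm_toBCF_eq_norm, one_mul]
      exact BoundedContinuousFunction.norm_le (norm_nonneg _) |>.2 fun u => norm_diag_le _ u)

lemma expRed_toCStarRed (f : C_c(G, ℂ)) (u : UnitSpace G) : expRed G (toCStarRed f) u = f u :=
  diag_regRep f u

/-- The functional `φ_μ(h) = ∫ h dμ` on `C_0(G⁽⁰⁾)`. -/
noncomputable def stateOf [MeasurableSpace (UnitSpace G)] (μ : Measure (UnitSpace G))
    (h : C₀(UnitSpace G, ℂ)) : ℂ := ∫ u, h u ∂μ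

/-- The copy of `C_c(X)` in `C^*_red(G)`: functions of compact support contained in `X`. -/
def ccOn (X : Set G) : Set (CStarRed G) := toCStarRed '' {f : C_c(G, ℂ) | tsupport f ⊆ X}

variable (G) in
/-- The copy of `C_0(G⁽⁰⁾)` in `C^*_red(G)`: the completion of `C_c(G⁽⁰⁾)`. -/
def c0Units : Set (CStarRed G) := closure (ccOn (unitSet G))

/-- The generating set `C_0(G⁽⁰⁾) ∪ ⋃_{X ∈ Xs} C_c(X)`. -/
def generators (Xs : Set (Set G)) : Set (CStarRed G) := c0Units G ∪ ⋃ X ∈ Xs, ccOn X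

/-- The `C^*`-subalgebra of `C^*_red(G)` generated by `C_0(G⁽⁰⁾) ∪ ⋃_{X ∈ Xs} C_c(X)`. -/
noncomputable def cstarGenerated (Xs : Set (Set G)) : NonUnitalStarSubalgebra ℂ (CStarRed G) :=
  (NonUnitalStarAlgebra.adjoin ℂ (generators Xs)).topologicalClosure

/-- A functional is tracial on a subalgebra (or subset) `B`. -/
def IsTracialOn (τ : CStarRed G → ℂ) (B : Set (CStarRed G)) : Prop :=
  ∀ a ∈ B, ∀ b ∈ B, τ (a * b) = τ (b * a)

end Topology

end EtaleGpd

open EtaleGpd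

/-! On a bisection `X` the set `X B X⁻¹` consists of the ranges of the arrows of `X` with source in
`B`. Since `r` and `s` embed `X` onto open sets, `μ` is `X`-balanced exactly when its pullbacks to
`X` along `r` and along `s` coincide (`isBalanced_iff_comap_eq`).

Let τ = φ_μ ∘ E_red, `f ∈ C_c(X)` and `g ∈ C_c(G)`. Injectivity of `r` and `s` on `X` leaves one
term in each convolution sum: `f × g` at the unit `r(x)` and `g × f` at the unit `s(x)` both equal
`f(x) g(x⁻¹)`. Hence τ(fg) and τ(gf) are integrals over `X` of one function against the two
pullbacks of `μ` (`traceState_mul_left`, `traceState_mul_right`).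

If `μ` is balanced, `C_c(X)` therefore lies in the centralizer of τ, a closed *-subalgebra, which
then contains everything generated. Conversely, taking for `g` the adjoint of a cutoff equal to 1 on
the support of `f` turns traciality into equality of the integrals of `f`, and Riesz uniqueness
gives equality of the pullbacks.

Balance passes to products and inverses of bisections because these compose and invert the partial
maps `s(x) ↦ r(x)`. The description by spans rests on the factorization of every element of
`C_c(XY)` as a product from `C_c(X)` and `C_c(Y)` (`exists_ccMul_eq`). -/

namespace EtaleGpd

open SetGroupoid EtaleGroupoid

/-! ### Products and inverses of subsets of a groupoid. -/

section SetAlgebra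

variable {G : Type*} [SetGroupoid G]

lemma mul_mul_inv_self {x d : G} (h : src x = rng d) : x⁻¹ * (x * d) = d :=
  inv_mul_mul (composable_iff.2 h)

lemma mul_inv_mul_self {x c : G} (h : rng x = rng c) : x * (x⁻¹ * c) = c := by
  simpa [inv_inv'] using mul_mul_inv_self (x := x⁻¹) (d := c) (by rw [src_inv, h])

lemma rng_inv_mul {x c : G} (h : rng x = rng c) : rng (x⁻¹ * c) = src x := by
  rw [rng_mul (by rw [src_inv, h]), rng_inv]

lemma mem_setMul {X Y : Set G} {c : G} :
    c ∈ setMul X Y ↔ ∃ x ∈ X, ∃ y ∈ Y, src x = rng y ∧ x * y = c := by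
  simp only [setMul, composable_iff, mem_ofPred_eq]

lemma mem_setInv {X : Set G} {c : G} : c ∈ setInv X ↔ c⁻¹ ∈ X :=
  ⟨by rintro ⟨a, ha, rfl⟩; rwa [inv_inv'], fun h => ⟨_, h, inv_inv' c⟩⟩

lemma setInv_eq_preimage (X : Set G) : setInv X = (fun a : G => a⁻¹) ⁻¹' X :=
  Set.ext fun _ => mem_setInv

lemma setInv_unitSet : setInv (unitSet G) = unitSet G := by
  ext c
  rw [mem_setInv]
  refine ⟨fun h => ?_, fun h => ?_⟩
  · have h' : IsUnitArrow c⁻¹ := h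
    rw [← inv_inv' c, inv_unit h']
    exact h
  · rwa [inv_unit (show IsUnitArrow c from h)]

lemma setMul_unitSet (X : Set G) : setMul X (unitSet G) = X := by
  ext c
  rw [mem_setMul]
  constructor
  · rintro ⟨x, hx, y, hy, h, rfl⟩
    rw [rng_unit ⟨y, hy⟩] at h
    have := mul_src_self x
    rw [h] at this
    rwa [show x * y = x from this]
  · exact fun h => ⟨c, h, src c, (src c).2, (rng_unit _).symm, mul_src_self c⟩

lemma unitSet_setMul (X : Set G) : setMul (unitSet G) X = X := by
  ext c
  rw [mem_setMul]
  constructor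
  · rintro ⟨y, hy, x, hx, h, rfl⟩
    rw [src_unit ⟨y, hy⟩] at h
    have := rng_mul_self x
    rw [← h] at this
    rwa [show y * x = x from this]
  · exact fun h => ⟨rng c, (rng c).2, c, h, src_unit _, rng_mul_self c⟩

lemma src_image_setInv (X : Set G) : src '' setInv X = rng '' X := by
  ext u
  constructor
  · rintro ⟨_, ⟨x, hx, rfl⟩, rfl⟩
    exact ⟨x, hx, (src_inv x).symm⟩
  · rintro ⟨x, hx, rfl⟩
    exact ⟨x⁻¹, ⟨x, hx, rfl⟩, src_inv x⟩

/-- `X B X⁻¹` consists of the ranges of the arrows of `X` with source in `B`. -/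
lemma conjugate_eq {X : Set G} (hX : InjOn (src : G → UnitSpace G) X) (B : Set (UnitSpace G)) :
    (Subtype.val ⁻¹' setMul (setMul X (Subtype.val '' B)) (setInv X) : Set (UnitSpace G)) =
      rng '' (X ∩ src ⁻¹' B) := by
  have hmul : setMul X (Subtype.val '' B) = X ∩ src ⁻¹' B := by
    ext c
    rw [mem_setMul]
    constructor
    · rintro ⟨x, hx, _, ⟨u, hu, rfl⟩, h, rfl⟩
      rw [rng_unit] at h
      subst h
      rw [mul_src_self]
      exact ⟨hx, hu⟩
    · rintro ⟨hc, hB⟩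
      exact ⟨c, hc, src c, ⟨_, hB, rfl⟩, (rng_unit _).symm, mul_src_self c⟩
  rw [hmul]
  ext u
  rw [mem_preimage, mem_setMul]
  constructor
  · rintro ⟨x, hx, _, ⟨y, hy, rfl⟩, h, hu⟩
    rw [rng_inv] at h
    -- Composability of `x` and `y⁻¹` says `s(x) = s(y)`, so only the products `x x⁻¹ = r(x)` occur.
    obtain rfl := hX hx.1 hy h
    exact ⟨x, hx, Subtype.ext hu⟩
  · rintro ⟨x, hx, rfl⟩
    exact ⟨x, hx, x⁻¹, ⟨x, hx.1, rfl⟩, (rng_inv x).symm, rfl⟩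

/-- Passing to maps on the subtype `X` makes the measurable embeddings given by a bisection
applicable. -/
lemma rng_image_inter_preimage (X : Set G) (B : Set (UnitSpace G)) :
    (rng '' (X ∩ src ⁻¹' B) : Set (UnitSpace G)) =
      X.domRestrict rng '' (X.domRestrict src ⁻¹' B) := by
  ext u
  constructor
  · rintro ⟨x, ⟨hx, hB⟩, rfl⟩
    exact ⟨⟨x, hx⟩, hB, rfl⟩
  · rintro ⟨x, hB, rfl⟩
    exact ⟨x, ⟨x.2, hB⟩, rfl⟩

lemma injOn_src_setMul {X Y : Set G} (hX : InjOn (src : G → UnitSpace G) X)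
    (hY : InjOn (src : G → UnitSpace G) Y) : InjOn (src : G → UnitSpace G) (setMul X Y) := by
  intro c hc d hd h
  obtain ⟨x, hx, y, hy, hxy, rfl⟩ := mem_setMul.1 hc
  obtain ⟨x', hx', y', hy', hxy', rfl⟩ := mem_setMul.1 hd
  rw [src_mul hxy, src_mul hxy'] at h
  obtain rfl := hY hy hy' h
  rw [hX hx hx' (hxy.trans hxy'.symm)]

lemma injOn_rng_setMul {X Y : Set G} (hX : InjOn (rng : G → UnitSpace G) X)
    (hY : InjOn (rng : G → UnitSpace G) Y) : InjOn (rng : G → UnitSpace G) (setMul X Y) := by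
  intro c hc d hd h
  obtain ⟨x, hx, y, hy, hxy, rfl⟩ := mem_setMul.1 hc
  obtain ⟨x', hx', y', hy', hxy', rfl⟩ := mem_setMul.1 hd
  rw [rng_mul hxy, rng_mul hxy'] at h
  obtain rfl := hX hx hx' h
  rw [hY hy hy' (hxy.symm.trans hxy')]

end SetAlgebra

/-! ### Bisections of an étale groupoid and their closure properties. -/

section Bisections

variable {G : Type*} [TopologicalSpace G] [EtaleGroupoid G]

lemma continuous_src : Continuous (src : G → UnitSpace G) := isLocalHomeomorph_src.continuous

lemma continuous_rng : Continuous (rng : G → UnitSpace G) := isLocalHomeomorph_rng.continuous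

/-- For `a` close to a unit `u`, both `a` and `r(a)` lie in a neighbourhood of `u` on which `r` is
injective. They have the same range, so `a = r(a)` is a unit. -/
lemma isOpen_unitSet : IsOpen (unitSet G) := by
  rw [isOpen_iff_mem_nhds]
  intro u hu
  obtain ⟨U, hU, huU, hr, -⟩ := exists_chart u
  have hru : (rng u : G) = u := congrArg Subtype.val (rng_unit ⟨u, hu⟩)
  have hc : Continuous fun a : G => (rng a : G) := continuous_subtype_val.comp continuous_rng
  filter_upwards [hU.mem_nhds huU, (hU.preimage hc).mem_nhds (by rwa [mem_preimage, hru])]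
    with a ha hra
  have : (rng a : G) = a := hr hra ha (rng_unit _)
  rw [← this]
  exact (rng a).2

/-- Local homeomorphisms are continuous and open, so on an open set only injectivity remains to be
checked. -/
lemma isBisection_iff {X : Set G} : IsBisection X ↔
    IsOpen X ∧ InjOn (src : G → UnitSpace G) X ∧ InjOn (rng : G → UnitSpace G) X := by
  refine ⟨fun h => ⟨h.1, injOn_iff_injective.2 h.2.1.injective,
    injOn_iff_injective.2 h.2.2.injective⟩, fun ⟨ho, hs, hr⟩ => ⟨ho, ?_, ?_⟩⟩
  · exact .of_continuous_injective_isOpenMap (continuous_src.comp continuous_subtype_val)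
      (injOn_iff_injective.1 hs) (isLocalHomeomorph_src.isOpenMap.comp ho.isOpenMap_subtype_val)
  · exact .of_continuous_injective_isOpenMap (continuous_rng.comp continuous_subtype_val)
      (injOn_iff_injective.1 hr) (isLocalHomeomorph_rng.isOpenMap.comp ho.isOpenMap_subtype_val)

lemma IsBisection.injOn_src {X : Set G} (h : IsBisection X) :
    InjOn (src : G → UnitSpace G) X := (isBisection_iff.1 h).2.1

lemma IsBisection.injOn_rng {X : Set G} (h : IsBisection X) :
    InjOn (rng : G → UnitSpace G) X := (isBisection_iff.1 h).2.2

lemma isBisection_unitSet : IsBisection (unitSet G) := by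
  refine isBisection_iff.2 ⟨isOpen_unitSet, fun a ha b hb h => ?_, fun a ha b hb h => ?_⟩
  · rw [src_unit ⟨a, ha⟩, src_unit ⟨b, hb⟩] at h
    exact congrArg Subtype.val h
  · rw [rng_unit ⟨a, ha⟩, rng_unit ⟨b, hb⟩] at h
    exact congrArg Subtype.val h

lemma IsBisection.setInv {X : Set G} (hX : IsBisection X) : IsBisection (setInv X) := by
  refine isBisection_iff.2 ⟨?_, fun a ha b hb h => ?_, fun a ha b hb h => ?_⟩
  · rw [setInv_eq_preimage]
    exact hX.1.preimage inv_continuous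
  · rw [mem_setInv] at ha hb
    rw [← rng_inv, ← rng_inv] at h
    rw [← inv_inv' a, hX.injOn_rng ha hb h, inv_inv']
  · rw [mem_setInv] at ha hb
    rw [← src_inv, ← src_inv] at h
    rw [← inv_inv' a, hX.injOn_src ha hb h, inv_inv']

/-- The inverse of the range map on a bisection. -/
lemma IsBisection.exists_section {X : Set G} (hX : IsBisection X) :
    ∃ σ : UnitSpace G → G, ContinuousOn σ (rng '' X) ∧ ∀ x ∈ X, σ (rng x) = x := by
  -- The partial homeomorphism below needs a nonempty domain; for empty `X` any map serves.
  rcases X.eq_empty_or_nonempty with rfl | ⟨x₀, hx₀⟩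
  · exact ⟨Subtype.val, by simp, by simp⟩
  have : Nonempty X := ⟨⟨x₀, hx₀⟩⟩
  have hX' := hX.2.2
  let e := hX'.toOpenPartialHomeomorph
  refine ⟨fun u => (e.symm u : G), ?_, fun x hx => ?_⟩
  · have : rng '' X = e.target := by
      simp [e, Set.range_domRestrict]
    rw [this]
    exact continuous_subtype_val.comp_continuousOn e.continuousOn_symm
  · exact congrArg Subtype.val (hX'.toOpenPartialHomeomorph_left_inv (x := ⟨x, hx⟩))

lemma IsBisection.isOpen_rng_image {X : Set G} (hX : IsBisection X) :
    IsOpen (rng '' X : Set (UnitSpace G)) :=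
  isLocalHomeomorph_rng.isOpenMap _ hX.1

lemma IsBisection.isOpen_src_image {X : Set G} (hX : IsBisection X) :
    IsOpen (src '' X : Set (UnitSpace G)) :=
  isLocalHomeomorph_src.isOpenMap _ hX.1

/-- With `σ` the inverse of `r` on `X`, an arrow `d` with range in `r(X)` equals `σ(r(d)) ·
(σ(r(d))⁻¹ d)`. The second factor varies continuously with `d`, so it stays in the open set `Y`. -/
lemma IsBisection.isOpen_setMul {X Y : Set G} (hX : IsBisection X) (hY : IsOpen Y) :
    IsOpen (setMul X Y) := by
  rw [isOpen_iff_mem_nhds]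
  intro c hc
  obtain ⟨x, hx, y, hy, hxy, rfl⟩ := mem_setMul.1 hc
  obtain ⟨σ, hσ, hσX⟩ := hX.exists_section
  have hV : IsOpen ((rng : G → UnitSpace G) ⁻¹' (rng '' X)) :=
    hX.isOpen_rng_image.preimage continuous_rng
  have hcont : ContinuousOn (fun d : G => (σ (rng d))⁻¹ * d) (rng ⁻¹' (rng '' X)) := by
    have h1 : ContinuousOn (fun d : G => σ (rng d)) (rng ⁻¹' (rng '' X)) :=
      hσ.comp continuous_rng.continuousOn fun d hd => hd
    refine mul_continuousOn.comp ((inv_continuous.comp_continuousOn h1).prodMk continuousOn_id) ?_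
    rintro d ⟨z, hz, hzd⟩
    refine composable_iff.2 ?_
    change src (σ (rng d))⁻¹ = rng d
    rw [src_inv, ← hzd, hσX z hz]
  have hr : rng (x * y) = rng x := rng_mul hxy
  filter_upwards [(hcont.isOpen_inter_preimage hV hY).mem_nhds
    ⟨⟨x, hx, hr.symm⟩, by rwa [mem_preimage, hr, hσX x hx, mul_mul_inv_self hxy]⟩]
  rintro d ⟨⟨z, hz, hzd⟩, hd⟩
  rw [mem_preimage, ← hzd, hσX z hz] at hd
  exact mem_setMul.2 ⟨z, hz, z⁻¹ * d, hd, (rng_inv_mul hzd).symm, mul_inv_mul_self hzd⟩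

lemma IsBisection.setMul {X Y : Set G} (hX : IsBisection X) (hY : IsBisection Y) :
    IsBisection (setMul X Y) :=
  isBisection_iff.2 ⟨hX.isOpen_setMul hY.1, injOn_src_setMul hX.injOn_src hY.injOn_src,
    injOn_rng_setMul hX.injOn_rng hY.injOn_rng⟩

lemma isBisection_of_mem_invSemigroup {Xs : Set (Set G)} (h : ∀ X ∈ Xs, IsBisection X)
    {X : Set G} (hX : X ∈ invSemigroup Xs) : IsBisection X := by
  induction hX with
  | of hX => exact h _ hX
  | mul _ _ h1 h2 => exact h1.setMul h2
  | inv _ h => exact h.setInv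

/-! ### Balanced measures. -/

section Balanced

variable [MeasurableSpace (UnitSpace G)] {μ : Measure (UnitSpace G)}

lemma isBalanced_iff {X : Set G} (hX : IsBisection X) : IsBalanced μ X ↔
    ∀ B : Set (UnitSpace G), MeasurableSet B →
      μ (rng '' (X ∩ src ⁻¹' B)) = μ (src '' X ∩ B) := by
  simp only [IsBalanced, conjugate_eq hX.injOn_src]

/-- Both `r` and `s` are the identity on units. This is what puts `C_0(G⁽⁰⁾)` in the centralizer for
every `μ`. -/
lemma isBalanced_unitSet : IsBalanced μ (unitSet G) := by
  rw [isBalanced_iff isBisection_unitSet]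
  intro B _
  congr 1
  ext u
  constructor
  · rintro ⟨a, ⟨ha, haB⟩, rfl⟩
    rw [rng_unit ⟨a, ha⟩]
    rw [mem_preimage, src_unit ⟨a, ha⟩] at haB
    exact ⟨⟨a, ha, src_unit ⟨a, ha⟩⟩, haB⟩
  · rintro ⟨-, hu⟩
    exact ⟨u, ⟨u.2, by rwa [mem_preimage, src_unit]⟩, rng_unit u⟩

variable [BorelSpace (UnitSpace G)]

lemma IsBisection.measurableSet_rng_image {X : Set G} (hX : IsBisection X)
    {B : Set (UnitSpace G)} (hB : MeasurableSet B) :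
    MeasurableSet (rng '' (X ∩ src ⁻¹' B) : Set (UnitSpace G)) := by
  let _ : MeasurableSpace X := borel X
  have : BorelSpace X := ⟨rfl⟩
  have h1 : MeasurableSet (X.domRestrict (src : G → UnitSpace G) ⁻¹' B) :=
    hX.2.1.measurableEmbedding.measurable hB
  rw [rng_image_inter_preimage]
  exact hX.2.2.measurableEmbedding.measurableSet_image.2 h1

/-- Write `X·B` for `r(X ∩ s⁻¹(B))`. Then `(XY)·B = X·(Y·B)`, and balance is applied first to `X`,
then to `Y`. In between, intersecting with `s(X)` amounts to cutting `B` down to `s(XY)`. -/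
lemma IsBalanced.setMul {X Y : Set G} (hX : IsBisection X) (hY : IsBisection Y)
    (hbX : IsBalanced μ X) (hbY : IsBalanced μ Y) : IsBalanced μ (setMul X Y) := by
  rw [isBalanced_iff (hX.setMul hY)]
  rw [isBalanced_iff hX] at hbX
  rw [isBalanced_iff hY] at hbY
  intro B hB
  set C : Set (UnitSpace G) := src '' EtaleGpd.setMul X Y with hC
  have hCm : MeasurableSet C := (hX.setMul hY).isOpen_src_image.measurableSet
  have hCiff : ∀ u, u ∈ C ↔ ∃ x ∈ X, ∃ y ∈ Y, src x = rng y ∧ src y = u := by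
    intro u
    constructor
    · rintro ⟨c, hc, rfl⟩
      obtain ⟨x, hx, y, hy, hxy, rfl⟩ := mem_setMul.1 hc
      exact ⟨x, hx, y, hy, hxy, (src_mul hxy).symm⟩
    · rintro ⟨x, hx, y, hy, hxy, rfl⟩
      exact ⟨x * y, mem_setMul.2 ⟨x, hx, y, hy, hxy, rfl⟩, src_mul hxy⟩
  have e1 : rng '' (EtaleGpd.setMul X Y ∩ src ⁻¹' B) =
      rng '' (X ∩ src ⁻¹' (rng '' (Y ∩ src ⁻¹' B))) := by
    ext u
    constructor
    · rintro ⟨c, ⟨hc, hcB⟩, rfl⟩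
      obtain ⟨x, hx, y, hy, hxy, rfl⟩ := mem_setMul.1 hc
      rw [mem_preimage, src_mul hxy] at hcB
      exact ⟨x, ⟨hx, y, ⟨hy, hcB⟩, hxy.symm⟩, (rng_mul hxy).symm⟩
    · rintro ⟨x, ⟨hx, y, ⟨hy, hyB⟩, hxy⟩, rfl⟩
      exact ⟨x * y, ⟨mem_setMul.2 ⟨x, hx, y, hy, hxy.symm, rfl⟩,
        by rwa [mem_preimage, src_mul hxy.symm]⟩, rng_mul hxy.symm⟩
  have e2 : src '' X ∩ rng '' (Y ∩ src ⁻¹' B) = rng '' (Y ∩ src ⁻¹' (C ∩ B)) := by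
    ext u
    constructor
    · rintro ⟨⟨x, hx, hxu⟩, y, ⟨hy, hyB⟩, rfl⟩
      exact ⟨y, ⟨hy, (hCiff _).2 ⟨x, hx, y, hy, hxu, rfl⟩, hyB⟩, rfl⟩
    · rintro ⟨y, ⟨hy, hyC, hyB⟩, rfl⟩
      obtain ⟨x, hx, z, hz, hxz, hzy⟩ := (hCiff _).1 hyC
      obtain rfl := hY.injOn_src hz hy hzy
      exact ⟨⟨x, hx, hxz⟩, z, ⟨hz, hyB⟩, rfl⟩
  have e3 : src '' Y ∩ (C ∩ B) = C ∩ B := by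
    refine inter_eq_right.2 ?_
    rintro u ⟨hu, -⟩
    obtain ⟨x, hx, y, hy, -, rfl⟩ := (hCiff _).1 hu
    exact ⟨y, hy, rfl⟩
  rw [e1, hbX _ (hY.measurableSet_rng_image hB), e2, hbY _ (hCm.inter hB), e3]

/-- Balance of `X` is applied to the set `s(X ∩ r⁻¹(B))`, which `X` carries back onto `r(X) ∩ B`. -/
lemma IsBalanced.setInv {X : Set G} (hX : IsBisection X) (hbX : IsBalanced μ X) :
    IsBalanced μ (setInv X) := by
  have hm : ∀ B : Set (UnitSpace G), MeasurableSet B →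
      MeasurableSet (src '' (X ∩ rng ⁻¹' B) : Set (UnitSpace G)) := by
    intro B hB
    convert hX.setInv.measurableSet_rng_image hB using 1
    ext u
    constructor
    · rintro ⟨x, ⟨hx, hxB⟩, rfl⟩
      exact ⟨x⁻¹, ⟨⟨x, hx, rfl⟩, by rwa [mem_preimage, src_inv]⟩, rng_inv x⟩
    · rintro ⟨_, ⟨⟨x, hx, rfl⟩, hxB⟩, rfl⟩
      exact ⟨x, ⟨hx, by rwa [mem_preimage, src_inv] at hxB⟩, (rng_inv x).symm⟩
  rw [isBalanced_iff hX.setInv]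
  rw [isBalanced_iff hX] at hbX
  intro B hB
  have e1 : (rng '' (EtaleGpd.setInv X ∩ src ⁻¹' B) : Set (UnitSpace G)) =
      src '' X ∩ src '' (X ∩ rng ⁻¹' B) := by
    ext u
    constructor
    · rintro ⟨_, ⟨⟨x, hx, rfl⟩, hxB⟩, rfl⟩
      rw [mem_preimage, src_inv] at hxB
      rw [rng_inv]
      exact ⟨⟨x, hx, rfl⟩, x, ⟨hx, hxB⟩, rfl⟩
    · rintro ⟨-, x, ⟨hx, hxB⟩, rfl⟩
      exact ⟨x⁻¹, ⟨⟨x, hx, rfl⟩, by rwa [mem_preimage, src_inv]⟩, rng_inv x⟩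
  have e2 : (rng '' (X ∩ src ⁻¹' (src '' (X ∩ rng ⁻¹' B))) : Set (UnitSpace G)) =
      rng '' X ∩ B := by
    ext u
    constructor
    · rintro ⟨x, ⟨hx, y, ⟨hy, hyB⟩, h⟩, rfl⟩
      obtain rfl := hX.injOn_src hy hx h
      exact ⟨⟨y, hy, rfl⟩, hyB⟩
    · rintro ⟨⟨x, hx, rfl⟩, hB⟩
      exact ⟨x, ⟨hx, x, ⟨hx, hB⟩, rfl⟩, rfl⟩
  rw [e1, ← hbX _ (hm B hB), e2, src_image_setInv]

lemma IsFamilyBalanced.invSemigroup {Xs : Set (Set G)} (h : ∀ X ∈ Xs, IsBisection X)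
    (hμ : IsFamilyBalanced μ Xs) : IsFamilyBalanced μ (invSemigroup Xs) := by
  intro X hX
  induction hX with
  | of hX => exact hμ _ hX
  | mul h1 h2 ih1 ih2 =>
    exact ih1.setMul (isBisection_of_mem_invSemigroup h h1)
      (isBisection_of_mem_invSemigroup h h2) ih2
  | inv h1 ih => exact ih.setInv (isBisection_of_mem_invSemigroup h h1)

/-- A measure is balanced for a bisection if and only if the range and the source map pull it back
to the same measure. -/
lemma isBalanced_iff_comap_eq {X : Set G} (hX : IsBisection X) [MeasurableSpace X]
    [BorelSpace X] : IsBalanced μ X ↔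
      μ.comap (X.domRestrict (rng : G → UnitSpace G)) =
        μ.comap (X.domRestrict (src : G → UnitSpace G)) := by
  have hr := hX.2.2.measurableEmbedding
  have hs := hX.2.1.measurableEmbedding
  rw [isBalanced_iff hX]
  constructor
  · intro h
    ext A hA
    -- Every Borel `A ⊆ X` is the preimage under `s` of the Borel set `s(A)`, so testing balance on
    -- `B = s(A)` suffices.
    have hA' : X.domRestrict src ⁻¹' (X.domRestrict src '' A) = A :=
      preimage_image_eq _ hs.injective
    have hsub : (src '' X : Set (UnitSpace G)) ∩ X.domRestrict src '' A =
        X.domRestrict src '' A := by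
      refine inter_eq_right.2 ?_
      rintro _ ⟨x, -, rfl⟩
      exact ⟨x, x.2, rfl⟩
    have := h _ (hs.measurableSet_image.2 hA)
    rwa [rng_image_inter_preimage, hA', hsub, ← hr.comap_apply, ← hs.comap_apply] at this
  · intro h B hB
    rw [rng_image_inter_preimage, ← hr.comap_apply, h, hs.comap_preimage, Set.range_domRestrict, inter_comm]

end Balanced

end Bisections

/-! ### Convolution with a function supported in a bisection. -/

section Convolution

variable {G : Type*} [SetGroupoid G]

/-- In a factorization `c = ab` with `a ∈ X` the ranges of `a` and `c` agree, which forces `a = x`: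
one term survives. -/
lemma conv_eq_mul_of_rng {f g : G → ℂ} {X : Set G} (hf : ∀ a ∉ X, f a = 0)
    (hX : InjOn (rng : G → UnitSpace G) X) {x c : G} (hx : x ∈ X) (h : rng x = rng c) :
    conv f g c = f x * g (x⁻¹ * c) := by
  have hc : Composable x (x⁻¹ * c) := composable_iff.2 (rng_inv_mul h).symm
  rw [conv, tsum_eq_single ⟨(x, x⁻¹ * c), hc, mul_inv_mul_self h⟩]
  rintro ⟨⟨a, b⟩, hab, habc⟩ hne
  by_cases ha : a ∈ X
  · refine absurd ?_ hne
    dsimp only at hab habc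
    have hax : a = x := hX ha hx (by rw [h, ← habc, rng_mul (composable_iff.1 hab)])
    subst hax
    simp only [← habc, inv_mul_mul hab]
  · simp [hf a ha]

lemma conv_eq_zero_of_rng {f g : G → ℂ} {X : Set G} (hf : ∀ a ∉ X, f a = 0) {c : G}
    (hc : (rng c : UnitSpace G) ∉ rng '' X) : conv f g c = 0 := by
  rw [conv]
  convert tsum_zero with p
  rw [hf p.1.1, zero_mul]
  exact fun h => hc ⟨_, h, (rng_mul (composable_iff.1 p.2.1)).symm.trans (congrArg rng p.2.2)⟩

lemma conv_eq_mul_of_src {f g : G → ℂ} {X : Set G} (hf : ∀ a ∉ X, f a = 0)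
    (hX : InjOn (src : G → UnitSpace G) X) {x c : G} (hx : x ∈ X) (h : src c = src x) :
    conv g f c = g (c * x⁻¹) * f x := by
  have hc : Composable (c * x⁻¹) x := composable_iff.2 (src_mul_inv h)
  rw [conv, tsum_eq_single ⟨(c * x⁻¹, x), hc, mul_inv_mul h⟩]
  rintro ⟨⟨b, a⟩, hab, habc⟩ hne
  by_cases ha : a ∈ X
  · refine absurd ?_ hne
    dsimp only at hab habc
    have hax : a = x := hX ha hx (by rw [← h, ← habc, src_mul (composable_iff.1 hab)])
    subst hax
    simp only [← habc, mul_mul_inv hab]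
  · simp [hf a ha]

lemma conv_eq_zero_of_src {f g : G → ℂ} {X : Set G} (hf : ∀ a ∉ X, f a = 0) {c : G}
    (hc : (src c : UnitSpace G) ∉ src '' X) : conv g f c = 0 := by
  rw [conv]
  convert tsum_zero with p
  rw [hf p.1.2, mul_zero]
  exact fun h => hc ⟨_, h, (src_mul (composable_iff.1 p.2.1)).symm.trans (congrArg src p.2.2)⟩

/-- Together with `conv_src` this is the core of the trace computation: reversing the factors keeps
the value and moves it from the unit `r(x)` to the unit `s(x)`. -/
lemma conv_rng {f : G → ℂ} (g : G → ℂ) {X : Set G} (hf : ∀ a ∉ X, f a = 0)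
    (hX : InjOn (rng : G → UnitSpace G) X) {x : G} (hx : x ∈ X) :
    conv f g (rng x : G) = f x * g x⁻¹ := by
  rw [conv_eq_mul_of_rng hf hX hx (rng_unit _).symm, ← src_inv, mul_src_self]

lemma conv_src {f : G → ℂ} (g : G → ℂ) {X : Set G} (hf : ∀ a ∉ X, f a = 0)
    (hX : InjOn (src : G → UnitSpace G) X) {x : G} (hx : x ∈ X) :
    conv g f (src x : G) = f x * g x⁻¹ := by
  rw [conv_eq_mul_of_src hf hX hx (src_unit _), ← rng_inv, rng_mul_self, mul_comm]

end Convolution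

/-! ### Supports, factorization and partitions of unity in `C_c(G)`. -/

section FunctionAlgebra

variable {G : Type*} [TopologicalSpace G] [EtaleGroupoid G]

lemma isCompact_setMul {K L : Set G} (hK : IsCompact K) (hL : IsCompact L) :
    IsCompact (setMul K L) := by
  have h : IsCompact ((K ×ˢ L) ∩ {p : G × G | Composable p.1 p.2}) := by
    refine (hK.prod hL).inter_right ?_
    simp only [composable_iff]
    exact isClosed_eq (continuous_src.comp continuous_fst) (continuous_rng.comp continuous_snd)
  convert h.image_of_continuousOn (mul_continuousOn.mono inter_subset_right) using 1
  ext c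
  constructor
  · rintro ⟨a, ha, b, hb, hab, rfl⟩
    exact ⟨(a, b), ⟨⟨ha, hb⟩, hab⟩, rfl⟩
  · rintro ⟨⟨a, b⟩, ⟨⟨ha, hb⟩, hab⟩, rfl⟩
    exact ⟨a, ha, b, hb, hab, rfl⟩

/-- The product of two compact sets is compact, hence closed, so taking the closure of the support
adds nothing outside it. -/
lemma tsupport_ccMul_subset (f g : C_c(G, ℂ)) :
    tsupport (ccMul f g) ⊆ setMul (tsupport f) (tsupport g) := by
  refine closure_minimal (fun c hc => ?_)
    (isCompact_setMul f.hasCompactSupport g.hasCompactSupport).isClosed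
  by_contra hne
  apply hc
  change conv f g c = 0
  rw [conv]
  convert tsum_zero with p
  by_contra h
  exact hne ⟨_, subset_tsupport _ (left_ne_zero_of_mul h), _,
    subset_tsupport _ (right_ne_zero_of_mul h), p.2.1, p.2.2⟩

lemma tsupport_ccStar_subset (f : C_c(G, ℂ)) : tsupport (ccStar f) ⊆ setInv (tsupport f) := by
  rw [setInv_eq_preimage]
  refine closure_minimal (fun c hc => subset_tsupport _ fun h => hc ?_)
    ((isClosed_tsupport f).preimage inv_continuous)
  change star (f c⁻¹) = 0
  rw [h, star_zero]

lemma setMul_mono {A B A' B' : Set G} (hA : A ⊆ A') (hB : B ⊆ B') : setMul A B ⊆ setMul A' B' :=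
  fun _ ⟨a, ha, b, hb, h⟩ => ⟨a, hA ha, b, hB hb, h⟩

lemma setInv_mono {A A' : Set G} (hA : A ⊆ A') : setInv A ⊆ setInv A' :=
  fun _ ⟨a, ha, h⟩ => ⟨a, hA ha, h⟩

lemma exists_cutoff {K X : Set G} (hK : IsCompact K) (hX : IsOpen X) (h : K ⊆ X) :
    ∃ p : C_c(G, ℂ), tsupport p ⊆ X ∧ ∀ x ∈ K, p x = 1 := by
  -- A partition of unity with a single member is a cutoff.
  obtain ⟨q, hq, hq1, -, hqc⟩ := exists_continuous_sum_one_of_isOpen_isCompact (n := 1)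
    (s := fun _ => X) (fun _ => hX) hK fun x hx => mem_iUnion.2 ⟨0, h hx⟩
  have hsub : tsupport (fun x => (q 0 x : ℂ)) ⊆ tsupport (q 0) :=
    closure_mono fun x hx => by simpa using hx
  refine ⟨⟨⟨fun x => (q 0 x : ℂ), by fun_prop⟩,
    (hqc 0).of_isClosed_subset (isClosed_tsupport _) hsub⟩, hsub.trans (hq 0), fun x hx => ?_⟩
  have := hq1 hx
  simp only [Fin.sum_univ_one, Fin.isValue, Pi.one_apply] at this
  change ((q 0 x : ℝ) : ℂ) = 1
  rw [this, Complex.ofReal_one]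

/-- Injectivity of `r` on `X` makes `X⁻¹X` consist of units. -/
lemma setMul_setInv_setMul_subset {X : Set G} (hX : InjOn (rng : G → UnitSpace G) X) (Y : Set G) :
    setMul (setInv X) (setMul X Y) ⊆ Y := by
  intro c hc
  obtain ⟨_, ⟨x', hx', rfl⟩, d, hd, h, rfl⟩ := mem_setMul.1 hc
  obtain ⟨x, hx, y, hy, hxy, rfl⟩ := mem_setMul.1 hd
  rw [src_inv, rng_mul hxy] at h
  obtain rfl := hX hx' hx h
  rwa [mul_mul_inv_self hxy]

/-- A function supported in a product `X Y` factors as a product of functions supported in `X`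
and in `Y`. -/
lemma exists_ccMul_eq {X Y : Set G} (hX : IsBisection X) {f : C_c(G, ℂ)}
    (hf : tsupport f ⊆ setMul X Y) : ∃ p q : C_c(G, ℂ), tsupport p ⊆ X ∧ tsupport q ⊆ Y ∧
      ccMul p q = f := by
  obtain ⟨σ, hσ, hσX⟩ := hX.exists_section
  have hsub : rng '' tsupport f ⊆ (rng '' X : Set (UnitSpace G)) := by
    rintro _ ⟨c, hc, rfl⟩
    obtain ⟨x, hx, y, -, hxy, rfl⟩ := mem_setMul.1 (hf hc)
    exact ⟨x, hx, (rng_mul hxy).symm⟩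
  have hK : IsCompact (σ '' (rng '' tsupport f)) :=
    (f.hasCompactSupport.image continuous_rng).image_of_continuousOn (hσ.mono hsub)
  have hKX : σ '' (rng '' tsupport f) ⊆ X := by
    rintro _ ⟨u, hu, rfl⟩
    obtain ⟨x, hx, rfl⟩ := hsub hu
    rwa [hσX x hx]
  -- `p` equals 1 at the `X`-factor `σ(r(c))` of every `c` in the support of `f`.
  obtain ⟨p, hp, hp1⟩ := exists_cutoff hK hX.1 hKX
  have hpX : ∀ a ∉ X, p a = 0 := fun a ha =>
    image_eq_zero_of_notMem_tsupport fun h => ha (hp h)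
  have hpX' : ∀ a ∉ setInv X, ccStar p a = 0 := fun a ha =>
    image_eq_zero_of_notMem_tsupport fun h => ha (setInv_mono hp (tsupport_ccStar_subset p h))
  -- With `q = p^* × f`, the product `p × q` at `c` is `|p(x)|² f(c)` for the `x ∈ X` with `r(x) =
  -- r(c)`, and `p(x) = 1` wherever `f(c) ≠ 0`. The support of `q` lies in `X⁻¹XY ⊆ Y`.
  refine ⟨p, ccMul (ccStar p) f, hp, ?_, ?_⟩
  · exact (tsupport_ccMul_subset _ _).trans ((setMul_mono
      ((tsupport_ccStar_subset p).trans (setInv_mono hp)) hf).trans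
      (setMul_setInv_setMul_subset hX.injOn_rng Y))
  · ext c
    change conv p (conv (ccStar p) f) c = f c
    by_cases hc : (rng c : UnitSpace G) ∈ rng '' X
    · obtain ⟨x, hx, hxc⟩ := hc
      rw [conv_eq_mul_of_rng hpX hX.injOn_rng hx hxc,
        conv_eq_mul_of_rng hpX' hX.setInv.injOn_rng ⟨x, hx, rfl⟩
          (by rw [rng_inv_mul hxc, rng_inv]), inv_inv', mul_inv_mul_self hxc]
      by_cases h0 : f c = 0
      · simp [h0]
      · have h1 : p x = 1 := hp1 x ⟨rng c, ⟨c, subset_tsupport _ h0, rfl⟩, by rw [← hxc, hσX x hx]⟩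
        have h2 : ccStar p x⁻¹ = 1 := by
          change star (p x⁻¹⁻¹) = 1
          rw [inv_inv', h1, star_one]
        rw [h1, h2, one_mul, one_mul]
    · rw [conv_eq_zero_of_rng hpX hc]
      symm
      by_contra h0
      exact hc (hsub ⟨c, subset_tsupport _ h0, rfl⟩)

/-! ### The map from `C_c(G)` to the reduced algebra -/

variable (G) in
/-- The embedding `C_c(G) → C^*_red(G)` as a linear map. -/
noncomputable def toCStarRedLinear : C_c(G, ℂ) →ₗ[ℂ] CStarRed G where
  toFun := toCStarRed
  map_add' f g := Subtype.ext (regRep_add f g)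
  map_smul' z f := Subtype.ext (regRep_smul z f)

lemma toCStarRed_mul (f g : C_c(G, ℂ)) :
    toCStarRed (ccMul f g) = toCStarRed f * toCStarRed g :=
  Subtype.ext (regRep_mul f g)

lemma toCStarRed_star (f : C_c(G, ℂ)) : toCStarRed (ccStar f) = star (toCStarRed f) :=
  Subtype.ext (regRep_star f)

lemma denseRange_toCStarRed : DenseRange (toCStarRed : C_c(G, ℂ) → CStarRed G) := by
  intro a
  rw [Metric.mem_closure_iff]
  intro ε hε
  have ha : (a : L2 G →L[ℂ] L2 G) ∈ closure (Set.range (regRep (G := G))) := a.2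
  obtain ⟨_, ⟨f, rfl⟩, hf⟩ := Metric.mem_closure_iff.1 ha ε hε
  exact ⟨_, ⟨f, rfl⟩, hf⟩

/-- A partition of unity subordinate to a finite subcover of the compact support cuts `f` into
finitely many pieces, so no closure is needed. -/
lemma toCStarRed_mem_span {Xs : Set (Set G)} (hXs : ∀ X ∈ Xs, IsOpen X) (f : C_c(G, ℂ))
    (hf : tsupport f ⊆ ⋃₀ Xs) : toCStarRed f ∈ Submodule.span ℂ (⋃ X ∈ Xs, ccOn X) := by
  obtain ⟨t, htXs, htf, ht⟩ := f.hasCompactSupport.isCompact.elim_finite_subcover_image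
    (c := fun X => X) hXs (by rwa [← sUnion_eq_biUnion])
  lift t to Finset (Set G) using htf
  let φ := t.equivFin.symm
  have hφ : ∀ i, (φ i : Set G) ∈ Xs := fun i => htXs (φ i).2
  obtain ⟨p, hp, hp1, -, -⟩ := exists_continuous_sum_one_of_isOpen_isCompact
    (s := fun i => (φ i : Set G)) (fun i => hXs _ (hφ i)) f.hasCompactSupport (by
      intro x hx
      obtain ⟨X, hX, hxX⟩ := Set.mem_iUnion₂.1 (ht hx)
      exact Set.mem_iUnion.2 ⟨φ.symm ⟨X, hX⟩, by simpa using hxX⟩)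
  let q : Fin t.card → C_c(G, ℂ) := fun i =>
    ⟨⟨fun x => (p i x : ℂ) * f x, by fun_prop⟩, f.hasCompactSupport.mul_left⟩
  have hsum : f = ∑ i, q i := by
    ext x
    rw [CompactlySupportedContinuousMap.sum_apply]
    change f x = ∑ i, (p i x : ℂ) * f x
    by_cases hx : x ∈ tsupport f
    · have h1 : ∑ i, p i x = 1 := by simpa using hp1 hx
      rw [← Finset.sum_mul, ← Complex.ofReal_sum, h1, Complex.ofReal_one, one_mul]
    · simp [image_eq_zero_of_notMem_tsupport hx]
  rw [hsum]
  change toCStarRedLinear G _ ∈ _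
  rw [map_sum]
  refine Submodule.sum_mem _ fun i _ => Submodule.subset_span ?_
  refine mem_iUnion₂.2 ⟨φ i, hφ i, q i, ?_, rfl⟩
  refine subset_trans (closure_mono fun x hx => ?_) (hp i)
  have hx : (p i x : ℂ) * f x ≠ 0 := hx
  simpa using left_ne_zero_of_mul hx

end FunctionAlgebra

/-! ### The generated C*-algebra as a closed linear span. -/

section Span

variable {G : Type*} [TopologicalSpace G] [EtaleGroupoid G]

lemma star_mem_ccOn_setInv {X : Set G} {a : CStarRed G} (ha : a ∈ ccOn X) :
    star a ∈ ccOn (setInv X) := by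
  obtain ⟨f, hf, rfl⟩ := ha
  exact ⟨ccStar f, (tsupport_ccStar_subset f).trans (setInv_mono hf), toCStarRed_star f⟩

lemma mul_mem_ccOn_setMul {X Y : Set G} {a b : CStarRed G} (ha : a ∈ ccOn X) (hb : b ∈ ccOn Y) :
    a * b ∈ ccOn (setMul X Y) := by
  obtain ⟨f, hf, rfl⟩ := ha
  obtain ⟨g, hg, rfl⟩ := hb
  exact ⟨ccMul f g, (tsupport_ccMul_subset f g).trans (setMul_mono hf hg), toCStarRed_mul f g⟩

/-- Induction over the inverse semigroup: `exists_ccMul_eq` handles products, the adjoint handles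
inverses. -/
lemma ccOn_subset_of_mem_invSemigroup {Xs : Set (Set G)} (h : ∀ X ∈ Xs, IsBisection X)
    {A : NonUnitalStarSubalgebra ℂ (CStarRed G)} (hA : ∀ X ∈ Xs, ccOn X ⊆ (A : Set (CStarRed G)))
    {X : Set G} (hX : X ∈ invSemigroup Xs) : ccOn X ⊆ (A : Set (CStarRed G)) := by
  induction hX with
  | of hX => exact hA _ hX
  | mul h1 _ ih1 ih2 =>
    rintro _ ⟨f, hf, rfl⟩
    obtain ⟨p, q, hp, hq, rfl⟩ := exists_ccMul_eq (isBisection_of_mem_invSemigroup h h1) hf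
    rw [toCStarRed_mul]
    exact mul_mem (ih1 ⟨p, hp, rfl⟩) (ih2 ⟨q, hq, rfl⟩)
  | @inv Y _ ih =>
    intro a ha
    have := ih (a := star a) (by
      have := star_mem_ccOn_setInv ha
      rwa [show setInv (setInv Y) = Y by ext c; simp [mem_setInv, inv_inv']] at this)
    rw [← star_star a]
    exact star_mem this

lemma ccOn_subset_cstarGenerated {Xs : Set (Set G)} {X : Set G} (hX : X ∈ Xs) :
    ccOn X ⊆ (cstarGenerated Xs : Set (CStarRed G)) := fun _ ha =>
  NonUnitalStarSubalgebra.le_topologicalClosure _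
    (NonUnitalStarAlgebra.subset_adjoin _ _ (Or.inr (mem_iUnion₂.2 ⟨X, hX, ha⟩)))

/-- The functions supported in the unit space or in a member of a family of sets. -/
def ccFamily (Xs : Set (Set G)) : Set (CStarRed G) := ⋃ X ∈ insert (unitSet G) Xs, ccOn X

lemma ccFamily_eq (Xs : Set (Set G)) : ccFamily Xs = ccOn (unitSet G) ∪ ⋃ X ∈ Xs, ccOn X :=
  biUnion_insert _ _ _

lemma mem_ccFamily {Xs : Set (Set G)} {a : CStarRed G} :
    a ∈ ccFamily Xs ↔ ∃ X ∈ insert (unitSet G) Xs, a ∈ ccOn X := by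
  simp only [ccFamily, mem_iUnion, exists_prop]

lemma setMul_mem_insert {Xs : Set (Set G)} {X Y : Set G}
    (hX : X ∈ insert (unitSet G) (invSemigroup Xs)) (hY : Y ∈ insert (unitSet G) (invSemigroup Xs)) :
    setMul X Y ∈ insert (unitSet G) (invSemigroup Xs) := by
  rcases hX with rfl | hX
  · rwa [unitSet_setMul]
  rcases hY with rfl | hY
  · rw [setMul_unitSet]; exact Or.inr hX
  exact Or.inr (.mul hX hY)

lemma setInv_mem_insert {Xs : Set (Set G)} {X : Set G}
    (hX : X ∈ insert (unitSet G) (invSemigroup Xs)) :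
    setInv X ∈ insert (unitSet G) (invSemigroup Xs) := by
  rcases hX with rfl | hX
  · exact Or.inl setInv_unitSet
  exact Or.inr (.inv hX)

/-- The family is already closed under products and adjoints, the unit space being neutral for set
products; only linear combinations are missing. -/
lemma adjoin_ccFamily (Xs : Set (Set G)) :
    ((NonUnitalStarAlgebra.adjoin ℂ (ccFamily (invSemigroup Xs)) :
      NonUnitalStarSubalgebra ℂ (CStarRed G)) : Set (CStarRed G)) =
      Submodule.span ℂ (ccFamily (invSemigroup Xs)) := by
  have hstar : star (ccFamily (invSemigroup Xs)) ⊆ ccFamily (invSemigroup Xs) := by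
    intro a ha
    obtain ⟨X, hX, haX⟩ := mem_ccFamily.1 (mem_star.1 ha)
    have := star_mem_ccOn_setInv haX
    rw [star_star] at this
    exact mem_ccFamily.2 ⟨_, setInv_mem_insert hX, this⟩
  let S : Subsemigroup (CStarRed G) :=
    { carrier := ccFamily (invSemigroup Xs)
      mul_mem' := fun {a b} ha hb => by
        obtain ⟨X, hX, haX⟩ := mem_ccFamily.1 ha
        obtain ⟨Y, hY, hbY⟩ := mem_ccFamily.1 hb
        exact mem_ccFamily.2 ⟨_, setMul_mem_insert hX hY, mul_mem_ccOn_setMul haX hbY⟩ }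
  have hS : Subsemigroup.closure (ccFamily (invSemigroup Xs) ∪ star (ccFamily (invSemigroup Xs))) =
      S := by
    rw [union_eq_left.2 hstar]
    exact Subsemigroup.closure_eq S
  have := NonUnitalStarAlgebra.adjoin_eq_span (R := ℂ) (ccFamily (invSemigroup Xs))
  rw [hS] at this
  exact congrArg (fun V : Submodule ℂ (CStarRed G) => (V : Set (CStarRed G))) this

lemma ccFamily_subset_generators (Xs : Set (Set G)) : ccFamily Xs ⊆ generators Xs := by
  rw [ccFamily_eq]
  exact union_subset_union_left _ subset_closure

/-- Up to closure `C_0(G⁽⁰⁾)` may be replaced by `C_c(G⁽⁰⁾)`, which multiplies like the other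
`C_c(X)`. -/
lemma generators_subset_closure (Xs : Set (Set G)) : generators Xs ⊆ closure (ccFamily Xs) := by
  rw [ccFamily_eq]
  exact union_subset (closure_mono subset_union_left) (subset_union_right.trans subset_closure)

lemma cstarGenerated_eq_closure_span {Xs : Set (Set G)} (h : ∀ X ∈ Xs, IsBisection X) :
    (cstarGenerated Xs : Set (CStarRed G)) =
      ((Submodule.span ℂ (generators (invSemigroup Xs))).topologicalClosure :
        Set (CStarRed G)) := by
  apply Subset.antisymm
  · let B : NonUnitalStarSubalgebra ℂ (CStarRed G) :=
      (NonUnitalStarAlgebra.adjoin ℂ (ccFamily (invSemigroup Xs))).topologicalClosure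
    have hB : (B : Set (CStarRed G)) =
        closure (Submodule.span ℂ (ccFamily (invSemigroup Xs)) : Set (CStarRed G)) := by
      rw [← adjoin_ccFamily]
      rfl
    have hsub : ccFamily Xs ⊆ ccFamily (invSemigroup Xs) :=
      biUnion_subset_biUnion_left (insert_subset_insert fun X hX => .of hX)
    have hle : cstarGenerated Xs ≤ B := by
      refine NonUnitalStarSubalgebra.topologicalClosure_minimal _
        (NonUnitalStarAlgebra.adjoin_le ?_) isClosed_closure
      refine (generators_subset_closure Xs).trans ?_
      rw [hB]
      exact closure_mono (hsub.trans Submodule.subset_span)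
    refine subset_trans hle ?_
    rw [hB, Submodule.topologicalClosure_coe]
    exact closure_mono (Submodule.span_mono (ccFamily_subset_generators _))
  · rw [Submodule.topologicalClosure_coe]
    refine closure_minimal ?_ isClosed_closure
    refine Submodule.span_le (p := (cstarGenerated Xs).toSubmodule).2 (union_subset ?_ ?_)
    · exact fun a ha => NonUnitalStarSubalgebra.le_topologicalClosure _
        (NonUnitalStarAlgebra.subset_adjoin _ _ (Or.inl ha))
    · exact iUnion₂_subset fun X hX =>
        ccOn_subset_of_mem_invSemigroup h (fun _ => ccOn_subset_cstarGenerated) hX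

end Span

/-! ### The functional φ_μ ∘ E_red and its centralizer. -/

section Trace

variable {G : Type*} [TopologicalSpace G] [EtaleGroupoid G]
  [MeasurableSpace (UnitSpace G)] [BorelSpace (UnitSpace G)]

lemma integrable_of_zeroAtInfty (μ : Measure (UnitSpace G)) [IsFiniteMeasure μ]
    (h : C₀(UnitSpace G, ℂ)) : Integrable h μ :=
  h.toBCF.integrable μ

/-- The functional `φ_μ ∘ E_red` as a bounded linear functional. -/
noncomputable def traceState (μ : Measure (UnitSpace G)) [IsFiniteMeasure μ] :
    CStarRed G →L[ℂ] ℂ :=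
  (LinearMap.mkContinuous
    ({  toFun := fun h => stateOf μ h
        map_add' := fun h k =>
          integral_add (integrable_of_zeroAtInfty μ h) (integrable_of_zeroAtInfty μ k)
        map_smul' := fun z h => integral_const_mul z (h : UnitSpace G → ℂ) } :
        C₀(UnitSpace G, ℂ) →ₗ[ℂ] ℂ)
    (μ.real univ) fun h => by
      rw [mul_comm, ← ZeroAtInftyContinuousMap.norm_toBCF_eq_norm]
      exact norm_integral_le_of_norm_le_const (.of_forall fun u => h.toBCF.norm_coe_le_norm u)).comp
    (expRed G)

variable {μ : Measure (UnitSpace G)} [IsFiniteMeasure μ]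

lemma traceState_apply (a : CStarRed G) : traceState μ a = stateOf μ (expRed G a) := rfl

lemma traceState_toCStarRed (f : C_c(G, ℂ)) :
    traceState μ (toCStarRed f) = ∫ u : UnitSpace G, f u ∂μ :=
  integral_congr_ae (.of_forall fun u => expRed_toCStarRed f u)

/-- The diagonal of an adjoint is the conjugate diagonal. This makes the centralizer closed under
adjoints. -/
lemma traceState_star (a : CStarRed G) : traceState μ (star a) = star (traceState μ a) := by
  rw [traceState_apply, traceState_apply, stateOf, stateOf]
  refine Eq.trans (integral_congr_ae (.of_forall fun u => ?_)) integral_conj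
  change star (a : L2 G →L[ℂ] L2 G) (delta (u : G)) u =
    star ((a : L2 G →L[ℂ] L2 G) (delta (u : G)) u)
  rw [ContinuousLinearMap.star_eq_adjoint, ← inner_delta,
    ContinuousLinearMap.adjoint_inner_right, ← inner_conj_symm, inner_delta]
  rfl

lemma integral_eq_integral_comap {X U : Type*} [MeasurableSpace X] [MeasurableSpace U]
    {e : X → U} (he : MeasurableEmbedding e) (ν : Measure U) {F : U → ℂ}
    (hF : ∀ u ∉ range e, F u = 0) : ∫ u, F u ∂ν = ∫ x, F (e x) ∂ν.comap e := by
  rw [← he.integral_map, he.map_comap, setIntegral_eq_integral_of_forall_compl_eq_zero hF]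

section Products

variable {X : Set G} [MeasurableSpace X] [BorelSpace X]

/-- On units `f × g` vanishes off `r(X)`, so its integral can be pulled back to `X` along `r`. For
the reversed product the integrand is the same and `s` replaces `r`. -/
lemma traceState_mul_left (hX : IsBisection X) {f : C_c(G, ℂ)} (hf : tsupport f ⊆ X)
    (g : C_c(G, ℂ)) : traceState μ (toCStarRed f * toCStarRed g) =
      ∫ x : X, f x * g (x : G)⁻¹ ∂μ.comap (X.domRestrict rng) := by
  have hf0 : ∀ a ∉ X, f a = 0 := fun a ha => image_eq_zero_of_notMem_tsupport fun h => ha (hf h)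
  rw [← toCStarRed_mul, traceState_toCStarRed,
    integral_eq_integral_comap hX.2.2.measurableEmbedding μ]
  · exact integral_congr_ae (.of_forall fun x => conv_rng g hf0 hX.injOn_rng x.2)
  · intro u hu
    rw [Set.range_domRestrict] at hu
    exact conv_eq_zero_of_rng hf0 (by rwa [rng_unit])

lemma traceState_mul_right (hX : IsBisection X) {f : C_c(G, ℂ)} (hf : tsupport f ⊆ X)
    (g : C_c(G, ℂ)) : traceState μ (toCStarRed g * toCStarRed f) =
      ∫ x : X, f x * g (x : G)⁻¹ ∂μ.comap (X.domRestrict src) := by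
  have hf0 : ∀ a ∉ X, f a = 0 := fun a ha => image_eq_zero_of_notMem_tsupport fun h => ha (hf h)
  rw [← toCStarRed_mul, traceState_toCStarRed,
    integral_eq_integral_comap hX.2.1.measurableEmbedding μ]
  · exact integral_congr_ae (.of_forall fun x => conv_src g hf0 hX.injOn_src x.2)
  · intro u hu
    rw [Set.range_domRestrict] at hu
    exact conv_eq_zero_of_src hf0 (by rwa [src_unit])

end Products

variable (μ) in
/-- The centralizer of the functional `φ_μ ∘ E_red`. -/
noncomputable def traceCentralizer : NonUnitalStarSubalgebra ℂ (CStarRed G) where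
  carrier := {a | ∀ b, traceState μ (a * b) = traceState μ (b * a)}
  add_mem' ha hb c := by rw [add_mul, mul_add, map_add, map_add, ha, hb]
  zero_mem' c := by rw [zero_mul, mul_zero]
  -- Cyclic rotation: τ(aa'c) = τ(a'ca) = τ(caa').
  mul_mem' {a a'} ha ha' c := by rw [mul_assoc, ha, mul_assoc, ha', mul_assoc]
  smul_mem' z a ha c := by rw [smul_mul_assoc, mul_smul_comm, map_smul, map_smul, ha]
  star_mem' {a} ha c := by
    have h := congrArg star (ha (star c))
    rwa [← traceState_star, ← traceState_star, star_mul, star_mul, star_star, eq_comm] at h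

lemma isClosed_traceCentralizer : IsClosed (traceCentralizer μ : Set (CStarRed G)) := by
  have : (traceCentralizer μ : Set (CStarRed G)) =
      ⋂ b, {a | traceState μ (a * b) = traceState μ (b * a)} := by
    ext a
    simp only [mem_iInter]
    exact Iff.rfl
  rw [this]
  exact isClosed_iInter fun b => isClosed_eq (by fun_prop) (by fun_prop)

/-- By density and continuity `b` may be taken in `C_c(G)`; balance then equates the two measures in
the trace formulas. -/
lemma ccOn_subset_traceCentralizer {X : Set G} (hX : IsBisection X) (hb : IsBalanced μ X) :
    ccOn X ⊆ (traceCentralizer μ : Set (CStarRed G)) := by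
  let _ : MeasurableSpace X := borel X
  have : BorelSpace X := ⟨rfl⟩
  rintro _ ⟨f, hf, rfl⟩ b
  refine denseRange_toCStarRed.induction_on b (isClosed_eq (by fun_prop) (by fun_prop)) fun g => ?_
  rw [traceState_mul_left hX hf, traceState_mul_right hX hf, (isBalanced_iff_comap_eq hX).1 hb]

lemma generators_subset_traceCentralizer {Xs : Set (Set G)} (h : ∀ X ∈ Xs, IsBisection X)
    (hμ : IsFamilyBalanced μ Xs) : generators Xs ⊆ (traceCentralizer μ : Set (CStarRed G)) := by
  refine union_subset (closure_minimal (ccOn_subset_traceCentralizer isBisection_unitSet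
    isBalanced_unitSet) isClosed_traceCentralizer) (iUnion₂_subset fun X hX => ?_)
  exact ccOn_subset_traceCentralizer (h X hX) (hμ X hX)

lemma cstarGenerated_le_traceCentralizer {Xs : Set (Set G)} (h : ∀ X ∈ Xs, IsBisection X)
    (hμ : IsFamilyBalanced μ Xs) : cstarGenerated Xs ≤ traceCentralizer μ :=
  NonUnitalStarSubalgebra.topologicalClosure_minimal _
    (NonUnitalStarAlgebra.adjoin_le (generators_subset_traceCentralizer h hμ))
    isClosed_traceCentralizer

/-- Together with the open unit space the family covers `G`, so `C_c(G)` is spanned by functions in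
the centralizer, which is closed. -/
lemma traceCentralizer_eq_univ {Xs : Set (Set G)} (h : ∀ X ∈ Xs, IsBisection X)
    (hμ : IsFamilyBalanced μ Xs) (hcov : (unitSet G)ᶜ ⊆ ⋃₀ Xs) (a : CStarRed G) :
    a ∈ traceCentralizer μ := by
  have hopen : ∀ X ∈ insert (unitSet G) Xs, IsOpen X := by
    rintro X (rfl | hX)
    exacts [isOpen_unitSet, (h X hX).1]
  refine denseRange_toCStarRed.induction_on a isClosed_traceCentralizer fun f => ?_
  have hf := toCStarRed_mem_span hopen f fun x _ => by
    by_cases hx : x ∈ unitSet G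
    · exact ⟨_, mem_insert _ _, hx⟩
    · obtain ⟨X, hX, hxX⟩ := hcov hx
      exact ⟨X, mem_insert_of_mem _ hX, hxX⟩
  refine Submodule.span_le (p := (traceCentralizer μ).toSubmodule).2 (iUnion₂_subset ?_) hf
  rintro X (rfl | hX)
  exacts [ccOn_subset_traceCentralizer isBisection_unitSet isBalanced_unitSet,
    ccOn_subset_traceCentralizer (h X hX) (hμ X hX)]

/-- Traciality on a subalgebra containing `C_c(X)` forces the measure to be `X`-balanced. -/
lemma isBalanced_of_isTracialOn {X : Set G} (hX : IsBisection X)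
    {A : NonUnitalStarSubalgebra ℂ (CStarRed G)} (hA : ccOn X ⊆ (A : Set (CStarRed G)))
    (h : IsTracialOn (traceState μ) (A : Set (CStarRed G))) : IsBalanced μ X := by
  let _ : MeasurableSpace X := borel X
  have : BorelSpace X := ⟨rfl⟩
  have : LocallyCompactSpace X := hX.1.locallyCompactSpace
  rw [isBalanced_iff_comap_eq hX]
  -- Riesz uniqueness on the locally compact space `X`: real functions `k` in `C_c(X)` determine the
  -- measure. Extension by zero, `k'`, makes `k` an element of `C_c(G)`.
  refine Measure.ext_of_integral_eq_on_compactlySupported fun k => ?_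
  let k' : G → ℝ := Subtype.val.extend k 0
  have hk' : ∀ x : X, k' x = k x := fun x => Subtype.val_injective.extend_apply _ _ _
  have hsub : tsupport k' ⊆ Subtype.val '' tsupport k :=
    k.hasCompactSupport.tsupport_extend_zero_subset continuous_subtype_val
  have hcont : Continuous k' := HasCompactSupport.continuous_extend_zero hX.1 k.continuous k.hasCompactSupport
  let f : C_c(G, ℂ) := ⟨⟨fun x => (k' x : ℂ), by fun_prop⟩, by
    have hk'c : HasCompactSupport k' :=
      (k.hasCompactSupport.image continuous_subtype_val).of_isClosed_subset
        (isClosed_tsupport _) hsub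
    exact hk'c.comp_left (g := fun t : ℝ => (t : ℂ)) Complex.ofReal_zero⟩
  have hf : tsupport f ⊆ X := by
    refine subset_trans (closure_mono fun x hx => ?_) (hsub.trans (Subtype.coe_image_subset _ _))
    have hx : (k' x : ℂ) ≠ 0 := hx
    exact fun h => hx (by rw [h, Complex.ofReal_zero])
  -- With `g = p^*` the integrand `f(x) g(x⁻¹)` is just `f(x)`, and `g` lies in `A` as the adjoint
  -- of an element of `C_c(X)`.
  obtain ⟨p, hp, hp1⟩ := exists_cutoff f.hasCompactSupport.isCompact hX.1 hf
  have hval : ∀ x : X, f x * ccStar p (x : G)⁻¹ = (k x : ℂ) := by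
    intro x
    have e1 : ccStar p (x : G)⁻¹ = star (p x) := by
      change star (p (x : G)⁻¹⁻¹) = _
      rw [inv_inv']
    have e2 : f x = (k x : ℂ) := congrArg Complex.ofReal (hk' x)
    by_cases h0 : f x = 0
    · rw [← e2, h0, zero_mul]
    · rw [e1, hp1 x (subset_tsupport _ h0), star_one, mul_one, e2]
  have hps : toCStarRed (ccStar p) ∈ A := by
    rw [toCStarRed_star]
    exact star_mem (hA ⟨p, hp, rfl⟩)
  have key := h _ (hA ⟨f, hf, rfl⟩) _ hps
  rw [traceState_mul_left hX hf, traceState_mul_right hX hf] at key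
  simp only [hval, integral_complex_ofReal] at key
  exact_mod_cast key

end Trace

end EtaleGpd

open EtaleGpd
theorem mainTheorem10 {G : Type*} [TopologicalSpace G] [EtaleGroupoid G]
    [MeasurableSpace (UnitSpace G)] [BorelSpace (UnitSpace G)]
    (𝒲 : Set (Set G)) (h𝒲 : ∀ W ∈ 𝒲, IsBisection W)
    (μ : Measure (UnitSpace G)) [IsProbabilityMeasure μ] :
    List.TFAE [
      IsFamilyBalanced μ 𝒲,
      IsFamilyBalanced μ (invSemigroup 𝒲),
      IsTracialOn (fun a => stateOf μ (expRed G a)) (cstarGenerated 𝒲 : Set (CStarRed G))] ∧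
    (cstarGenerated 𝒲 : Set (CStarRed G)) =
      ((Submodule.span ℂ (generators (invSemigroup 𝒲))).topologicalClosure :
        Set (CStarRed G)) ∧
    ((unitSet G)ᶜ ⊆ ⋃₀ invSemigroup 𝒲 → IsFamilyBalanced μ 𝒲 →
      IsTracialOn (fun a => stateOf μ (expRed G a)) Set.univ) := by
  refine ⟨?_, cstarGenerated_eq_closure_span h𝒲, fun hcov hμ a _ b _ => ?_⟩
  · tfae_have 1 → 2 := fun h => h.invSemigroup h𝒲
    tfae_have 2 → 1 := fun h W hW => h W (.of hW)
    tfae_have 1 → 3 := fun h a ha b _ => cstarGenerated_le_traceCentralizer h𝒲 h ha b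
    tfae_have 3 → 1 := fun h W hW =>
      isBalanced_of_isTracialOn (h𝒲 W hW) (ccOn_subset_cstarGenerated hW) h
    tfae_finish
  · exact traceCentralizer_eq_univ (fun _ => isBisection_of_mem_invSemigroup h𝒲)
      (hμ.invSemigroup h𝒲) hcov a b
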